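/- Let $X$ be a real separable (infinite-dimensional) Hilbert space and let $A$ be a skew-adjoint operator on $X$ ($A^*=-A$, densely defined) such that $A^*A$ has compact resolvent. Fix an orthonormal basis $(e_j)_{j\in\mathbb N}$ of $X$ made of eigenvectors of $A^*A$, with eigenvalues $\lambda_j\ge 0$ in nondecreasing order, and fix $\sigma\ge 0$. Let $X^\sigma=D((A^*A)^{\sigma/2})\subseteq X$ be equipped with the graph norm $\|x\|_{X^\sigma}=(\|x\|_X^2+\|(A^*A)^{\sigma/2}x\|_X^2)^{1/2}$. Let $\mathcal P_n$ be the orthogonal projection onto $\mathrm{span}\{e_j : j<n\}$ and $\mathcal Q_n=I-\mathcal P_n$, both considered on $X^\sigma$. Let $e^{tA}$ be the unitary group generated by $A$. Solutions of evolution equations $\partial_t u=Au+g$ are understood in the mild sense $u(t)=e^{tA}u(0)+\int_0^t e^{(t-s)A}g(s)\,ds$. Let $X^\sigma_{\mathbb C}=X^\sigma+iX^\sigma$ with $\|x+iy\|^2=\|x\|^2+\|y\|^2$. For $S>0$, $R>0$ and $\mathcal A\subseteq X^\sigma$ put $$\mathcal B_R^{[0,S]}(X^\sigma,\mathcal A)=\{y\in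 C^0([0,S],X^\sigma):\ \|y(t)\|_{X^\sigma}\le R\ \text{and}\ y(t)\in\mathcal A\ \text{for all } t\in[0,S]\}.$$ Let $0<T<T^*$, $R_0,R_1>0$, $n_0\in\mathbb N$. Let $\mathcal A\subseteq X^\sigma$ be compact with $\mathcal P_n\mathcal A\subseteq\mathcal A$ for all $n$, and let $\mathcal K\subseteq C^0([0,T^*],X^\sigma)$ be compact, with $\|\phi\|_{C^0([0,T^*],X^\sigma)}\le R_0$ and $\mathcal P_n\phi\in\mathcal K$ for all $\phi\in\mathcal K$ and all $n$. Assume the following. 1. (Nonlinearity.) $\mathfrak f:X^\sigma\to X^\sigma$ is of class $C^2$ and bounded on bounded sets, and $D\mathfrak f$ is bounded and Lipschitz on the closed ball of radius $4R_0$ of $X^\sigma$. Moreover, for some $\delta,L>0$, $\mathfrak f$ restricted to that ball extends to a map, still denoted $\mathfrak f$, from the cylinder $\mathbb B=\{z\in X^\sigma_{\mathbb C}:\|\mathrm{Re}\,z\|\le 4R_0,\ \|\mathrm{Im}\,z\|\le 2\delta\}$ to $X^\sigma_{\mathbb C}$ which is continuous on $\mathbb B$ and holomorphic in its interior, and such that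 $\|\mathfrak f(z)\|\le L$ and $\|\mathfrak f(z)-\mathfrak f(z')\|\le L\|z-z'\|$ for $z,z'\in\mathbb B$, and $\|D\mathfrak f(z)-D\mathfrak f(z')\|\le L\|z-z'\|$ for $z,z'$ in the interior of $\mathbb B$. 2. (Uniform observability at high frequency.) $\mathbf C$ is a bounded linear operator on $X^\sigma$ and there is $\mathfrak C_{obs}>0$ such that, for all $n\ge n_0$, all $v\in\mathcal B_{3R_0}^{[0,T]}(X^\sigma,\mathcal A+\mathcal A)$ and every mild solution $w\in C^0([0,T],\mathcal Q_nX^\sigma)$ of $\partial_t w=(A+\mathcal Q_nD\mathfrak f(v))w$ on $[0,T]$, $$\|w(0)\|_{X^\sigma}^2\le\mathfrak C_{obs}^2\int_0^T\|\mathbf C w(t)\|_{X^\sigma}^2\,dt .$$ 3. (Sources.) $\mathfrak h_1\in\mathcal B_{R_0}^{[0,T^*]}(X^\sigma,\mathcal A)\cap\mathcal K$ and $\mathfrak h_2\in\mathcal B_{R_1}^{[0,T^*]}(X^\sigma,\mathcal A)$, and for some $\mu>0$ both extend to continuous maps $[0,T^*]+i[-\mu,\mu]\to X^\sigma_{\mathbb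 C}$ that are holomorphic in $(0,T^*)+i(-\mu,\mu)$, with $\|\mathrm{Re}\,\mathfrak h_1(z)\|_{X^\sigma}\le R_0$ for all $z\in[0,T^*]+i[-\mu,\mu]$. Then every $u\in\mathcal K$ such that $u(t)\in\mathcal A$ for all $t\in[0,T^*]$ and which is a mild solution of $$\partial_t u=Au+\mathfrak f(u+\mathfrak h_1)+\mathfrak h_2\ \text{ on }[0,T^*],\qquad \mathbf C u(t)=0\ \text{ for } t\in[0,T^*],$$ is real analytic as a function of $t\in(0,T^*)$ with values in $X^\sigma$. -/

import Mathlib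

open Set
open scoped Pointwise

noncomputable section

/-! ### Unbounded operators -/

section Operators

variable {X : Type*} [NormedAddCommGroup X] [InnerProductSpace ℝ X]

/-- A densely defined operator `A` on the Hilbert space `X` is skew-adjoint if `A* = -A`
(equality of unbounded operators, domains included). -/
structure IsSkewAdjointOp [CompleteSpace X] (A : X →ₗ.[ℝ] X) : Prop where
  dense_domain : Dense (A.domain : Set X)
  adjoint_eq : A.adjoint = -A

/-- The operator `A* A`, with domain `{x ∈ D(A) | A x ∈ D(A*)}`. -/
def adjointMulSelf [CompleteSpace X] (A : X →ₗ.[ℝ] X) : X →ₗ.[ℝ] X :=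
  A.adjoint.comp
    (A.domRestrict ((A.adjoint.domain.comap A.toFun).map A.domain.subtype)) (by
      rintro ⟨x, hx⟩
      obtain ⟨y, hy, rfl⟩ := hx.1
      exact hy)

/-- `B` has compact resolvent: for some real `μ` the operator `B - μ` is a bijection from `D(B)`
onto `X` whose inverse `R` is a compact operator on `X`. -/
def HasCompactResolvent (B : X →ₗ.[ℝ] X) : Prop :=
  ∃ (μ : ℝ) (R : X →L[ℝ] X), IsCompactOperator R ∧
    (∀ y : X, ∃ h : R y ∈ B.domain, B ⟨R y, h⟩ - μ • R y = y) ∧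
    ∀ x : B.domain, R (B x - μ • (x : X)) = x

/-- `e` is an orthonormal basis of `X` made of eigenvectors of `B`, with eigenvalues `lam j`
in nondecreasing order. -/
structure IsEigenbasis (B : X →ₗ.[ℝ] X) (e : HilbertBasis ℕ ℝ X) (lam : ℕ → ℝ) : Prop where
  mono : Monotone lam
  eigen : ∀ j, ∃ h : e j ∈ B.domain, B ⟨e j, h⟩ = lam j • e j

/-- `U` is a strongly continuous one-parameter group of bounded operators on `X` whose
infinitesimal generator is `A`. -/
structure IsGroupGeneratedBy (A : X →ₗ.[ℝ] X) (U : ℝ → X →L[ℝ] X) : Prop where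
  map_zero : U 0 = ContinuousLinearMap.id ℝ X
  map_add : ∀ s t, U (s + t) = (U s).comp (U t)
  continuous : ∀ x, Continuous fun t => U t x
  generator : ∀ x y : X,
    HasDerivAt (fun t => U t x) y 0 ↔ ∃ h : x ∈ A.domain, A ⟨x, h⟩ = y

open Classical in
/-- The group `t ↦ e^{tA}`: the (unique) strongly continuous group with generator `A`. It exists
for every skew-adjoint `A`; for an operator that generates no group the value is `0`. -/
def expGroup (A : X →ₗ.[ℝ] X) : ℝ → X →L[ℝ] X :=
  if h : ∃ U : ℝ → X →L[ℝ] X, IsGroupGeneratedBy A U then h.choose else 0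

end Operators

/-! ### The spaces `X^σ` -/

section Scale

variable {X : Type*} [NormedAddCommGroup X] [InnerProductSpace ℝ X]

/-- For `B e_j = lam j • e_j`, the operator `B^{σ/2}` is the one that multiplies the `j`-th
coordinate by `(lam j)^{σ/2}`, on the domain of all `x ∈ X` for which the resulting sequence is the
coordinate sequence of an element of `X`. The space `X^σ = D(B^{σ/2})` with its graph norm
`(‖x‖² + ‖B^{σ/2} x‖²)^{1/2}` is realized as the graph of `B^{σ/2}` in the Hilbert sum `X ⊕ X`:
the element `x ∈ D(B^{σ/2})` is the pair `(x, B^{σ/2} x)`. -/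
def scaleSubmodule (e : HilbertBasis ℕ ℝ X) (lam : ℕ → ℝ) (σ : ℝ) :
    Submodule ℝ (WithLp 2 (X × X)) where
  carrier := {p | ∀ j, inner ℝ (e j) p.snd = lam j ^ (σ / 2) * inner ℝ (e j) p.fst}
  add_mem' := by
    intro p q hp hq j
    have h1 := hp j
    have h2 := hq j
    simp only [WithLp.add_snd, WithLp.add_fst, inner_add_right, h1, h2]
    ring
  zero_mem' := by
    intro j
    simp
  smul_mem' := by
    intro c p hp j
    have h1 := hp j
    simp only [WithLp.smul_snd, WithLp.smul_fst, inner_smul_right, h1]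
    ring

/-- The Hilbert space `X^σ`. -/
abbrev Scale (e : HilbertBasis ℕ ℝ X) (lam : ℕ → ℝ) (σ : ℝ) : Type _ :=
  scaleSubmodule e lam σ

instance [CompleteSpace X] (e : HilbertBasis ℕ ℝ X) (lam : ℕ → ℝ) (σ : ℝ) :
    CompleteSpace (Scale e lam σ) := by
  have hcl : IsClosed (scaleSubmodule e lam σ : Set (WithLp 2 (X × X))) := by
    have : (scaleSubmodule e lam σ : Set (WithLp 2 (X × X))) =
        ⋂ j, {p | inner ℝ (e j) p.snd = lam j ^ (σ / 2) * inner ℝ (e j) p.fst} := by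
      ext p
      simp [scaleSubmodule]
    rw [this]
    refine isClosed_iInter fun j => isClosed_eq ?_ ?_ <;> fun_prop
  exact hcl.completeSpace_coe

/-- The inclusion `X^σ ↪ X`. -/
def Scale.toX {e : HilbertBasis ℕ ℝ X} {lam : ℕ → ℝ} {σ : ℝ} (x : Scale e lam σ) : X :=
  (x : WithLp 2 (X × X)).fst

theorem Scale.toX_injective {e : HilbertBasis ℕ ℝ X} {lam : ℕ → ℝ} {σ : ℝ} :
    Function.Injective (Scale.toX : Scale e lam σ → X) := by
  rintro ⟨p, hp⟩ ⟨q, hq⟩ h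
  have h1 : p.fst = q.fst := h
  have h2 : p.snd = q.snd := by
    apply e.repr.injective
    ext j
    rw [e.repr_apply_apply, e.repr_apply_apply, hp j, hq j, h1]
  apply Subtype.ext
  show p = q
  apply (WithLp.equiv 2 (X × X)).injective
  exact Prod.ext h1 h2

/-- The projection `x ↦ ∑_{j < n} ⟪e_j, x⟫ e_j` of `X` onto the span of `e_0, …, e_{n-1}`. -/
def lowProjX (e : HilbertBasis ℕ ℝ X) (n : ℕ) : X →L[ℝ] X :=
  ∑ j ∈ Finset.range n, (innerSL ℝ (e j)).smulRight (e j)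

theorem inner_lowProjX (e : HilbertBasis ℕ ℝ X) (n j : ℕ) (x : X) :
    inner ℝ (e j) (lowProjX e n x) = if j < n then inner ℝ (e j) x else 0 := by
  have horth : ∀ i k, inner ℝ (e i) (e k) = if i = k then (1 : ℝ) else 0 :=
    orthonormal_iff_ite.mp e.orthonormal
  simp [lowProjX, inner_sum, inner_smul_right, horth]

/-- The low-frequency projection `P_n` on `X^σ`: the restriction of `lowProjX` to `X^σ`. -/
def lowProj (e : HilbertBasis ℕ ℝ X) (lam : ℕ → ℝ) (σ : ℝ) (n : ℕ) :
    Scale e lam σ →L[ℝ] Scale e lam σ :=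
  (((WithLp.prodContinuousLinearEquiv 2 ℝ X X).symm.toContinuousLinearMap.comp
    (((lowProjX e n).prodMap (lowProjX e n)).comp
      (WithLp.prodContinuousLinearEquiv 2 ℝ X X).toContinuousLinearMap)).comp
        (scaleSubmodule e lam σ).subtypeL).codRestrict (scaleSubmodule e lam σ) (by
    rintro ⟨p, hp⟩ j
    have h := hp j
    show inner ℝ (e j) (lowProjX e n p.snd)
      = lam j ^ (σ / 2) * inner ℝ (e j) (lowProjX e n p.fst)
    rw [inner_lowProjX, inner_lowProjX]
    split_ifs
    · exact h
    · simp)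

theorem toX_lowProj (e : HilbertBasis ℕ ℝ X) (lam : ℕ → ℝ) (σ : ℝ) (n : ℕ)
    (x : Scale e lam σ) : (lowProj e lam σ n x).toX = lowProjX e n x.toX := rfl

/-- The high-frequency projection `Q_n = I - P_n` on `X^σ`, i.e. the projection onto the closed
span of `{e_j | j ≥ n}`. -/
def highProj (e : HilbertBasis ℕ ℝ X) (lam : ℕ → ℝ) (σ : ℝ) (n : ℕ) :
    Scale e lam σ →L[ℝ] Scale e lam σ :=
  ContinuousLinearMap.id ℝ (Scale e lam σ) - lowProj e lam σ n

/-- `u ∈ C⁰([0,T], X^σ)` is a mild solution of `∂ₜ u = A u + g` on `[0,T]`: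
`u(t) = e^{tA} u(0) + ∫₀ᵗ e^{(t-s)A} g(s) ds` for all `t ∈ [0,T]`.
(An identity between elements of `X^σ ⊆ X`; values of `g` outside `[0,T]` are not used.) -/
def IsMildSolution (A : X →ₗ.[ℝ] X) {e : HilbertBasis ℕ ℝ X} {lam : ℕ → ℝ} {σ : ℝ}
    {T : ℝ} (hT : 0 ≤ T) (u : C(Icc 0 T, Scale e lam σ)) (g : Icc 0 T → Scale e lam σ) : Prop :=
  ∀ t : Icc 0 T,
    (u t).toX = expGroup A t (u ⟨0, left_mem_Icc.2 hT⟩).toX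
      + ∫ s in (0 : ℝ)..t, expGroup A (t - s) (g (projIcc 0 T hT s)).toX

end Scale

/-! ### Complexification -/

section Complexification

variable {E : Type*} [NormedAddCommGroup E] [InnerProductSpace ℝ E]

/-- The canonical complexification `E_ℂ = E + iE` of a real Hilbert space, with
`‖x + iy‖² = ‖x‖² + ‖y‖²`. -/
def Complexified (E : Type*) [NormedAddCommGroup E] [InnerProductSpace ℝ E] : Type _ :=
  WithLp 2 (E × E)

namespace Complexified

instance : NormedAddCommGroup (Complexified E) :=
  inferInstanceAs (NormedAddCommGroup (WithLp 2 (E × E)))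

/-- The real part of `x + iy`. -/
def re (z : Complexified E) : E := WithLp.fst (p := 2) (α := E) (β := E) z

/-- The imaginary part of `x + iy`. -/
def im (z : Complexified E) : E := WithLp.snd (p := 2) (α := E) (β := E) z

/-- The element `x + iy`. -/
def mk (x y : E) : Complexified E := WithLp.toLp 2 (x, y)

/-- The embedding `x ↦ x + i0`. -/
def ofReal (x : E) : Complexified E := mk x 0

theorem ext {z w : Complexified E} (h1 : z.re = w.re) (h2 : z.im = w.im) : z = w :=
  (WithLp.equiv 2 (E × E)).injective (Prod.ext h1 h2)

instance : SMul ℂ (Complexified E) where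
  smul c z := mk (c.re • z.re - c.im • z.im) (c.im • z.re + c.re • z.im)

@[simp] theorem re_smul (c : ℂ) (z : Complexified E) :
    (c • z).re = c.re • z.re - c.im • z.im := rfl
@[simp] theorem im_smul (c : ℂ) (z : Complexified E) :
    (c • z).im = c.im • z.re + c.re • z.im := rfl
@[simp] theorem re_add (z w : Complexified E) : (z + w).re = z.re + w.re := rfl
@[simp] theorem im_add (z w : Complexified E) : (z + w).im = z.im + w.im := rfl
@[simp] theorem re_zero : (0 : Complexified E).re = 0 := rfl
@[simp] theorem im_zero : (0 : Complexified E).im = 0 := rfl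

theorem norm_sq (z : Complexified E) : ‖z‖ ^ 2 = ‖z.re‖ ^ 2 + ‖z.im‖ ^ 2 :=
  WithLp.prod_norm_sq_eq_of_L2 (α := E) (β := E) z

instance : Module ℂ (Complexified E) where
  one_smul z := by apply ext <;> simp
  mul_smul a b z := by
    apply ext <;> simp only [re_smul, im_smul, Complex.mul_re, Complex.mul_im] <;> module
  smul_zero a := by apply ext <;> simp
  smul_add a z w := by
    apply ext <;> simp only [re_smul, im_smul, re_add, im_add] <;> module
  add_smul a b z := by
    apply ext <;> simp only [re_smul, im_smul, re_add, im_add, Complex.add_re, Complex.add_im]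
      <;> module
  zero_smul z := by apply ext <;> simp

instance : NormedSpace ℂ (Complexified E) where
  norm_smul_le c z := by
    apply le_of_eq
    rw [← sq_eq_sq₀ (norm_nonneg _) (by positivity), mul_pow, norm_sq, norm_sq z, re_smul, im_smul,
      norm_sub_sq_real, norm_add_sq_real, Complex.sq_norm, Complex.normSq_apply]
    simp only [norm_smul, inner_smul_left, inner_smul_right, mul_pow, Real.norm_eq_abs, sq_abs]
    simp
    ring

end Complexified

/-- The cylinder `𝔹_{M,δ}(E) = {z ∈ E_ℂ | ‖Re z‖ ≤ M and ‖Im z‖ ≤ δ}`. -/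
def cylinder (E : Type*) [NormedAddCommGroup E] [InnerProductSpace ℝ E] (M δ : ℝ) :
    Set (Complexified E) :=
  {z | ‖z.re‖ ≤ M ∧ ‖z.im‖ ≤ δ}

/-- The assumption on the nonlinearity `f : E → E`, with radius `R₀`: `f` is `C²`, bounded on
bounded sets, `Df` is bounded and Lipschitz on the closed ball of radius `4R₀`, and `f` extends to a
map `F` on the cylinder `𝔹_{4R₀,2δ}(E)`, continuous there and holomorphic in its interior, with
`F`, the Lipschitz constant of `F` and that of `DF` bounded by `L`. -/
structure NonlinearityAssumption {E : Type*} [NormedAddCommGroup E] [InnerProductSpace ℝ E]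
    (f : E → E) (R₀ : ℝ) : Prop where
  contDiff : ContDiff ℝ 2 f
  bounded : ∀ B : Set E, Bornology.IsBounded B → Bornology.IsBounded (f '' B)
  fderiv_bounded : ∃ M : ℝ, ∀ x ∈ Metric.closedBall (0 : E) (4 * R₀), ‖fderiv ℝ f x‖ ≤ M
  fderiv_lipschitz : ∃ K : NNReal,
    LipschitzOnWith K (fderiv ℝ f) (Metric.closedBall (0 : E) (4 * R₀))
  holomorphic : ∃ δ > 0, ∃ L > 0, ∃ F : Complexified E → Complexified E,
    (∀ x ∈ Metric.closedBall (0 : E) (4 * R₀),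
      F (Complexified.ofReal x) = Complexified.ofReal (f x)) ∧
    ContinuousOn F (cylinder E (4 * R₀) (2 * δ)) ∧
    DifferentiableOn ℂ F (interior (cylinder E (4 * R₀) (2 * δ))) ∧
    (∀ z ∈ cylinder E (4 * R₀) (2 * δ), ‖F z‖ ≤ L) ∧
    (∀ z ∈ cylinder E (4 * R₀) (2 * δ), ∀ z' ∈ cylinder E (4 * R₀) (2 * δ),
      ‖F z - F z'‖ ≤ L * ‖z - z'‖) ∧
    ∀ z ∈ interior (cylinder E (4 * R₀) (2 * δ)),
      ∀ z' ∈ interior (cylinder E (4 * R₀) (2 * δ)),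
        ‖fderiv ℂ F z - fderiv ℂ F z'‖ ≤ L * ‖z - z'‖

/-- `H` extends `h ∈ C⁰([0,T], E)` to the closed rectangle `[0,T] + i[-μ,μ]`, continuously there
and holomorphically in the open rectangle `(0,T) + i(-μ,μ)`, with values in `E_ℂ`. -/
structure IsHolomorphicExtension {T : ℝ} (h : C(Icc 0 T, E)) (μ : ℝ)
    (H : ℂ → Complexified E) : Prop where
  extends_real : ∀ t : Icc 0 T, H ((t : ℝ) : ℂ) = Complexified.ofReal (h t)
  continuousOn : ContinuousOn H (Icc 0 T ×ℂ Icc (-μ) μ)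
  differentiableOn : DifferentiableOn ℂ H (Ioo 0 T ×ℂ Ioo (-μ) μ)

end Complexification

/-! ### Observability at high frequency -/

section Observability

variable {X : Type*} [NormedAddCommGroup X] [InnerProductSpace ℝ X]

/-- `w ∈ C⁰([0,T], Q_n X^σ)` is the mild solution of `∂ₜ w = (A + Q_n Df(v)) w` on `[0,T]`, i.e.
`w(t) = S_n(v)(t,0) w(0)`: the evolution operator `S_n(v)(·,0)` maps `w₀ ∈ Q_n X^σ` to the unique
such `w` with `w(0) = w₀`. -/
def IsHighFreqLinearSolution (A : X →ₗ.[ℝ] X) {e : HilbertBasis ℕ ℝ X} {lam : ℕ → ℝ} {σ : ℝ}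
    (f : Scale e lam σ → Scale e lam σ) {T : ℝ} (hT : 0 ≤ T) (n : ℕ)
    (v w : C(Icc 0 T, Scale e lam σ)) : Prop :=
  (∀ t, w t ∈ range (highProj e lam σ n)) ∧
  IsMildSolution A hT w (fun s => highProj e lam σ n (fderiv ℝ f (v s) (w s)))

/-- Observability inequality on `[0,T]` for `C`, uniform in `n ≥ n₀` and in the potential `v ∈ V`:
`‖w₀‖² ≤ Cobs² ∫₀ᵀ ‖C S_n(v)(t,0) w₀‖² dt` for all `w₀ ∈ Q_n X^σ`. -/
def UniformObservability (A : X →ₗ.[ℝ] X) {e : HilbertBasis ℕ ℝ X} {lam : ℕ → ℝ} {σ : ℝ}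
    (f : Scale e lam σ → Scale e lam σ) (C : Scale e lam σ →L[ℝ] Scale e lam σ)
    {T : ℝ} (hT : 0 ≤ T) (n₀ : ℕ) (V : Set C(Icc 0 T, Scale e lam σ)) : Prop :=
  ∃ Cobs > 0, ∀ n ≥ n₀, ∀ v ∈ V, ∀ w : C(Icc 0 T, Scale e lam σ),
    IsHighFreqLinearSolution A f hT n v w →
      ‖w ⟨0, left_mem_Icc.2 hT⟩‖ ^ 2
        ≤ Cobs ^ 2 * ∫ t in (0 : ℝ)..T, ‖C (w (projIcc 0 T hT t))‖ ^ 2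

end Observability

/-- `𝓑_R^{[0,T]}(E, 𝒜)`: the continuous `y : [0,T] → E` with `‖y‖ ≤ R` and `y(t) ∈ 𝒜` for all
`t ∈ [0,T]`. -/
def pathBall {E : Type*} [NormedAddCommGroup E] (T R : ℝ) (𝒜 : Set E) : Set C(Icc 0 T, E) :=
  {y | ‖y‖ ≤ R ∧ ∀ t, y t ∈ 𝒜}

end

/-!
The solution is analytic because, on a time window of length `T`, its high frequencies are an
analytic function of its low frequencies, and its low frequencies solve an ordinary differential
equation.

Since `A* A` has compact resolvent, its eigenvalues jump at some `n ≥ n₀`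
(`IsEigenbasis.exists_gap`). The group `e^{tA}` exists, is isometric and preserves the eigenspaces of
`A* A`; hence, for such an `n`, it acts on `X^σ` by isometries that commute with `P = P_n`, and `A P`
is bounded (`isGroupGeneratedBy_expGroup`, `exists_scaleGroup`). Put `Q = 1 - P`.

Fix a window `[t₀, t₀ + T]` inside `(0, T*)` and regard the path `s ↦ u (t + s)`, for `t` near `t₀`,
as a point of `C([0, T], X^σ)`. Its high-frequency part `W = Q u` solves the linear equation
`∂ₛ W = (A + Q Df(v)) W + Q g`, where `v` is the path of `u + h₁` at `t = t₀` and
`g = f (u + h₁) + h₂ - Df(v) W`; moreover `C W = -C P u`. By the observability inequality, the map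
that sends an initial value to the observation of the homogeneous solution in `L²(0, T; X^σ)` is
bounded below; its target being a Hilbert space, it has a bounded left inverse. Hence there are
bounded operators `Θ₁`, `Θ₂` with `W = -Θ₁ (C P u) + Θ₂ (Q g)` (`exists_reconstruction`).

In this identity `g` depends on `W` itself, but its derivative in `W` vanishes at `t = t₀`, because
`f` was linearized there. The holomorphic implicit function theorem in the complexification of
`C([0, T], X^σ)` therefore solves it for `W`, as a holomorphic function of `P u` and of the time,
which enters through the holomorphic extensions of the sources. Now
`∂ₜ P u = A P u + P (f (u + h₁) + h₂)` is a differential equation for the path `P u` with a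
holomorphic right-hand side, so that `P u`, and with it `W`, extends holomorphically in `t`
(`exists_contDiffAt_of_coupled_system`). Evaluating at a point of the window gives the claim
(`analyticAt_of_observable_window`).
-/

noncomputable section

/-! ### Superposition operators on spaces of continuous functions -/

section Superposition

open Filter Topology

variable {K : Type*} [TopologicalSpace K]
  {𝕜 : Type*} [RCLike 𝕜]
  {E F : Type*} [NormedAddCommGroup E] [NormedSpace 𝕜 E] [NormedAddCommGroup F] [NormedSpace 𝕜 F]

open Classical in
/-- The superposition operator `y ↦ G ∘ y` on `C(K, E)`. It takes the value `0` at those `y` for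
which `G ∘ y` is not continuous. -/
def superpose {E F : Type*} [TopologicalSpace E] [TopologicalSpace F] [Zero F]
    (G : E → F) (y : C(K, E)) : C(K, F) :=
  if h : Continuous (G ∘ y) then ⟨G ∘ y, h⟩ else 0

theorem superpose_apply {E F : Type*} [TopologicalSpace E] [TopologicalSpace F] [Zero F]
    {G : E → F} {U : Set E} (hG : ContinuousOn G U) {y : C(K, E)}
    (hy : ∀ k, y k ∈ U) (k : K) : superpose G y k = G (y k) := by
  have h : Continuous (G ∘ y) := hG.comp_continuous y.continuous hy
  simp [superpose, h]

variable [CompactSpace K]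

/-- Pointwise application of a continuous family of operators, as an operator on `C(K, E)`. -/
def mulOp : C(K, E →L[𝕜] F) →L[𝕜] C(K, E) →L[𝕜] C(K, F) :=
  LinearMap.mkContinuous₂
    (LinearMap.mk₂ 𝕜 (fun (a : C(K, E →L[𝕜] F)) (y : C(K, E)) =>
      (⟨fun k => a k (y k), a.continuous.clm_apply y.continuous⟩ : C(K, F)))
      (fun _ _ _ => by ext; simp) (fun _ _ _ => by ext; simp)
      (fun _ _ _ => by ext; simp) (fun _ _ _ => by ext; simp)) 1 (fun a y => by
        rw [one_mul, ContinuousMap.norm_le _ (by positivity)]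
        intro k
        exact (a k).le_of_opNorm_le_of_le (a.norm_coe_le_norm k) (y.norm_coe_le_norm k))

@[simp] theorem mulOp_apply (a : C(K, E →L[𝕜] F)) (y : C(K, E)) (k : K) :
    mulOp a y k = a k (y k) := rfl

theorem isOpen_forall_mem {E : Type*} [TopologicalSpace E] {U : Set E} (hU : IsOpen U) :
    IsOpen {y : C(K, E) | ∀ k, y k ∈ U} := by
  have := ContinuousMap.isOpen_setOfPred_mapsTo (X := K) (Y := E) isCompact_univ hU
  simpa [MapsTo] using this

/-- A map that is continuous on an open set is uniformly continuous near the compact range of a path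
in it. -/
theorem exists_forall_dist_lt {E F : Type*} [PseudoMetricSpace E] [PseudoMetricSpace F]
    {D : E → F} {U : Set E} (hU : IsOpen U) (hD : ContinuousOn D U)
    (y : C(K, E)) (hy : ∀ k, y k ∈ U) {ε : ℝ} (hε : 0 < ε) :
    ∃ δ > 0, ∀ k, ∀ x, dist x (y k) < δ → x ∈ U ∧ dist (D x) (D (y k)) < ε := by
  have hc : IsCompact (range y) := isCompact_range y.continuous
  obtain ⟨δ₁, hδ₁, h1⟩ := hc.exists_thickening_subset_open hU (by rintro _ ⟨k, rfl⟩; exact hy k)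
  have h2 := hc.uniformContinuousAt_of_continuousAt D
    (by rintro _ ⟨k, rfl⟩; exact hD.continuousAt (hU.mem_nhds (hy k))) (Metric.dist_mem_uniformity hε)
  obtain ⟨δ₂, hδ₂, h2⟩ := Metric.mem_uniformity_dist.1 h2
  refine ⟨min δ₁ δ₂, lt_min hδ₁ hδ₂, fun k x hx => ⟨h1 ?_, ?_⟩⟩
  · exact Metric.mem_thickening_iff.2 ⟨y k, ⟨k, rfl⟩, hx.trans_le (min_le_left _ _)⟩
  · have := h2 (a := y k) (b := x) (by rw [dist_comm]; exact hx.trans_le (min_le_right _ _)) ⟨k, rfl⟩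
    rw [dist_comm]; exact this

theorem continuousOn_superpose {D : E → F} {U : Set E} (hU : IsOpen U) (hD : ContinuousOn D U) :
    ContinuousOn (superpose D : C(K, E) → C(K, F)) {y | ∀ k, y k ∈ U} := by
  intro y hy
  refine ContinuousAt.continuousWithinAt ?_
  rw [Metric.continuousAt_iff]
  intro ε hε
  obtain ⟨δ, hδ, h⟩ := exists_forall_dist_lt hU hD y hy (half_pos hε)
  refine ⟨δ, hδ, fun {z} hz => ?_⟩
  have hzk : ∀ k, dist (z k) (y k) < δ := fun k => (ContinuousMap.dist_apply_le_dist k).trans_lt hz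
  refine lt_of_le_of_lt ((ContinuousMap.dist_le (half_pos hε).le).2 fun k => ?_) (half_lt_self hε)
  rw [superpose_apply hD hy, superpose_apply hD fun k => (h k _ (hzk k)).1]
  exact (h k _ (hzk k)).2.le

theorem hasFDerivAt_superpose {G : E → F} {U : Set E} (hU : IsOpen U) (hG : ContDiffOn 𝕜 1 G U)
    {y : C(K, E)} (hy : ∀ k, y k ∈ U) :
    HasFDerivAt (superpose G : C(K, E) → C(K, F)) (mulOp (superpose (fderiv 𝕜 G) y)) y := by
  have hD : ContinuousOn (fderiv 𝕜 G) U := hG.continuousOn_fderiv_of_isOpen hU le_rfl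
  rw [hasFDerivAt_iff_isLittleO, Asymptotics.isLittleO_iff]
  intro ε hε
  obtain ⟨δ, hδ, h⟩ := exists_forall_dist_lt hU hD y hy hε
  filter_upwards [Metric.ball_mem_nhds y hδ] with z hz
  have hzk : ∀ k, dist (z k) (y k) < δ := fun k => (ContinuousMap.dist_apply_le_dist k).trans_lt hz
  rw [ContinuousMap.norm_le _ (by positivity)]
  intro k
  let _ : NormedSpace ℝ E := NormedSpace.restrictScalars ℝ 𝕜 E
  have hmv := (convex_ball (y k) δ).norm_image_sub_le_of_norm_hasFDerivWithin_le' (𝕜 := 𝕜) (f := G)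
    (f' := fderiv 𝕜 G) (φ := fderiv 𝕜 G (y k)) (C := ε)
    (fun x hx => ((hG.differentiableOn one_ne_zero).differentiableAt
      (hU.mem_nhds (h k x hx).1)).hasFDerivAt.hasFDerivWithinAt)
    (fun x hx => by rw [← dist_eq_norm]; exact (h k x hx).2.le)
    (Metric.mem_ball_self hδ) (hzk k)
  simp only [ContinuousMap.sub_apply, mulOp_apply, superpose_apply hD hy,
    superpose_apply hG.continuousOn hy,
    superpose_apply hG.continuousOn fun k => (h k _ (hzk k)).1]
  exact hmv.trans (mul_le_mul_of_nonneg_left ((z - y).norm_coe_le_norm k) hε.le)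

/-- The superposition operator of a `C¹` map is `C¹` in the supremum norm. -/
theorem contDiffOn_superpose {G : E → F} {U : Set E} (hU : IsOpen U) (hG : ContDiffOn 𝕜 1 G U) :
    ContDiffOn 𝕜 1 (superpose G : C(K, E) → C(K, F)) {y | ∀ k, y k ∈ U} := by
  intro y hy
  refine ContDiffAt.contDiffWithinAt (contDiffAt_one_iff.2
    ⟨fun y => mulOp (superpose (fderiv 𝕜 G) y), _, (isOpen_forall_mem hU).mem_nhds hy, ?_,
      fun z hz => hasFDerivAt_superpose hU hG hz⟩)
  exact mulOp.continuous.comp_continuousOn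
    (continuousOn_superpose hU (hG.continuousOn_fderiv_of_isOpen hU le_rfl))

theorem contDiffAt_superpose {G : E → F} {U : Set E} (hU : IsOpen U) (hG : ContDiffOn 𝕜 1 G U)
    {y : C(K, E)} (hy : ∀ k, y k ∈ U) : ContDiffAt 𝕜 1 (superpose G : C(K, E) → C(K, F)) y :=
  (contDiffOn_superpose hU hG).contDiffAt ((isOpen_forall_mem hU).mem_nhds hy)

end Superposition

/-! ### Holomorphic dependence: implicit functions and differential equations -/

section HolomorphicODE

open Filter Topology

/-- The holomorphic implicit function theorem, normalized so that the partial derivative in the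
unknown is the identity. -/
theorem exists_implicitFunction {E₁ E₂ : Type*} [NormedAddCommGroup E₁] [NormedSpace ℂ E₁]
    [CompleteSpace E₁] [NormedAddCommGroup E₂] [NormedSpace ℂ E₂] [CompleteSpace E₂]
    {f : E₁ × E₂ → E₂} {a : E₁} {b : E₂} (hf : ContDiffAt ℂ 1 f (a, b))
    (h2 : HasFDerivAt (fun y => f (a, y)) (ContinuousLinearMap.id ℂ E₂) b) :
    ∃ ψ : E₁ → E₂, ψ a = b ∧ ContDiffAt ℂ 1 ψ a ∧
      ∀ᶠ v in 𝓝 (a, b), f v = f (a, b) → ψ v.1 = v.2 := by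
  have hd : HasFDerivAt f (fderiv ℂ f (a, b)) (a, b) :=
    (hf.differentiableAt one_ne_zero).hasFDerivAt
  have hpar : HasFDerivAt (fun y => f (a, y))
      ((fderiv ℂ f (a, b)).comp (ContinuousLinearMap.inr ℂ E₁ E₂)) b :=
    hd.comp b (hasFDerivAt_prodMk_right a b)
  have hinv : (fderiv ℂ f (a, b) ∘L .inr ℂ E₁ E₂).IsInvertible := by
    rw [hpar.unique h2]
    exact ⟨ContinuousLinearEquiv.refl ℂ E₂, rfl⟩
  exact ⟨hf.implicitFunction one_ne_zero hinv, hf.implicitFunction_apply_self one_ne_zero hinv,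
    hf.contDiffAt_implicitFunction one_ne_zero hinv,
    (hf.eventually_apply_eq_iff_implicitFunction one_ne_zero hinv).mono fun v hv => hv.1⟩

variable {Z : Type*} [NormedAddCommGroup Z] [NormedSpace ℂ Z]

/-- The operator `y ↦ ∫₀ᵗ y(s) ds` on `C([0,1], Z)`. -/
def primitiveOp [CompleteSpace Z] : C(Icc (0 : ℝ) 1, Z) →L[ℂ] C(Icc (0 : ℝ) 1, Z) :=
  LinearMap.mkContinuous
    { toFun := fun y => ⟨fun t => ∫ s in (0 : ℝ)..t, y (projIcc 0 1 zero_le_one s),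
        (intervalIntegral.continuous_primitive (fun a b =>
          (y.continuous.comp continuous_projIcc).intervalIntegrable a b) 0).comp
            continuous_subtype_val⟩
      map_add' := fun y z => by
        ext t
        exact intervalIntegral.integral_add
          ((y.continuous.comp continuous_projIcc).intervalIntegrable _ _)
          ((z.continuous.comp continuous_projIcc).intervalIntegrable _ _)
      map_smul' := fun c y => by
        ext t
        exact intervalIntegral.integral_smul c _ } 1 (fun y => by
    rw [one_mul, ContinuousMap.norm_le _ (norm_nonneg y)]
    intro t
    refine (intervalIntegral.norm_integral_le_of_norm_le_const
      (C := ‖y‖) fun s _ => y.norm_coe_le_norm _).trans ?_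
    rw [sub_zero, abs_of_nonneg t.2.1]
    exact mul_le_of_le_one_right (norm_nonneg y) t.2.2)

theorem primitiveOp_apply [CompleteSpace Z] (y : C(Icc (0 : ℝ) 1, Z)) (t : Icc (0 : ℝ) 1) :
    primitiveOp y t = ∫ s in (0 : ℝ)..t, y (projIcc 0 1 zero_le_one s) := rfl

/-- Solutions of a holomorphic differential equation in a Banach space are restrictions of
holomorphic functions. The rescaled solution `y(τ) = V(zτ) - V(0)`, `τ ∈ [0,1]`, solves
`y(τ) = z ∫₀^τ Φ(zs, V(0) + y(s)) ds`, and the implicit function theorem makes `y` a holomorphic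
function of `z`. -/
theorem exists_contDiffAt_of_integral_eq [CompleteSpace Z] {Φ : ℂ × Z → Z} {V : ℝ → Z}
    (hV : Continuous V) (hΦ : ContDiffAt ℂ 1 Φ (0, V 0))
    (hint : ∀ᶠ t in 𝓝 (0 : ℝ), V t = V 0 + ∫ r in (0 : ℝ)..t, Φ (r, V r)) :
    ∃ ψ : ℂ → Z, ContDiffAt ℂ 1 ψ 0 ∧ ψ 0 = V 0 ∧ ∀ᶠ t : ℝ in 𝓝 0, ψ t = V t := by
  obtain ⟨U₀, hU₀, hΦ₀⟩ := hΦ.contDiffOn le_rfl (by simp)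
  obtain ⟨U, hUU₀, hU, h0U⟩ := mem_nhds_iff.1 hU₀
  have hΦU : ContDiffOn ℂ 1 Φ U := hΦ₀.mono hUU₀
  let a : C(Icc (0 : ℝ) 1, ℂ × Z) := ⟨fun k => (((k : ℝ) : ℂ), 0), by fun_prop⟩
  let ℓ : C(Icc (0 : ℝ) 1, Z) →L[ℂ] C(Icc (0 : ℝ) 1, ℂ × Z) :=
    (ContinuousLinearMap.inr ℂ ℂ Z).compLeftContinuous ℂ (Icc (0 : ℝ) 1)
  let c : ℂ × C(Icc (0 : ℝ) 1, Z) → C(Icc (0 : ℝ) 1, ℂ × Z) := fun p =>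
    ContinuousMap.const _ (0, V 0) + p.1 • a + ℓ p.2
  have hc : ∀ p k, c p k = (p.1 * ((k : ℝ) : ℂ), V 0 + p.2 k) := by
    intro p k
    ext <;> simp [c, a, ℓ]
  have hcd : ContDiff ℂ 1 c := by fun_prop
  -- the rescaled solutions are the zeros of `f`, with `z` and `y` as the variables
  let f : ℂ × C(Icc (0 : ℝ) 1, Z) → C(Icc (0 : ℝ) 1, Z) := fun p =>
    p.2 - p.1 • primitiveOp (superpose Φ (c p))
  have hc0 : ∀ k, c (0, 0) k ∈ U := fun k => by rw [hc]; simpa using h0U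
  have hf : ContDiffAt ℂ 1 f (0, 0) := by
    have h1 : ContDiffAt ℂ 1 (fun p => superpose Φ (c p)) ((0 : ℂ), (0 : C(Icc (0 : ℝ) 1, Z))) :=
      (contDiffAt_superpose hU hΦU hc0).comp _ hcd.contDiffAt
    have h2 := h1.continuousLinearMap_comp (primitiveOp (Z := Z))
    exact contDiffAt_snd.sub (contDiffAt_fst.smul h2)
  have hf2 : HasFDerivAt (fun y => f (0, y)) (ContinuousLinearMap.id ℂ _) 0 := by
    have : (fun y => f (0, y)) = id := by ext1 y; simp [f]
    rw [this]; exact hasFDerivAt_id _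
  obtain ⟨ψ, hψ0, hψ, huniq⟩ := exists_implicitFunction hf hf2
  let y : ℝ → C(Icc (0 : ℝ) 1, Z) := fun t => ⟨fun k => V (t * k) - V 0, by fun_prop⟩
  have hy : Continuous y := ContinuousMap.continuous_of_continuous_uncurry _ (by
    show Continuous fun p : ℝ × Icc (0 : ℝ) 1 => V (p.1 * p.2) - V 0
    fun_prop)
  have hy0 : y 0 = 0 := by ext k; simp [y]
  have hlim : Tendsto (fun t : ℝ => ((t : ℂ), y t)) (𝓝 0) (𝓝 (0, 0)) := by
    have : Continuous fun t : ℝ => ((t : ℂ), y t) := by fun_prop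
    simpa [hy0] using this.tendsto 0
  have hUV : ∀ᶠ t : ℝ in 𝓝 0, ((t : ℂ), V t) ∈ U := by
    have : Continuous fun t : ℝ => ((t : ℂ), V t) := by fun_prop
    exact this.continuousAt.eventually_mem (hU.mem_nhds (by simpa using h0U))
  obtain ⟨ρ, hρ, hball⟩ := Metric.eventually_nhds_iff_ball.1 (hint.and hUV)
  have hsol : ∀ t ∈ Metric.ball (0 : ℝ) ρ, f ((t : ℂ), y t) = 0 := by
    intro t ht
    have htk : ∀ s ∈ Icc (0 : ℝ) 1, t * s ∈ Metric.ball (0 : ℝ) ρ := by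
      intro s hs
      rw [mem_ball_zero_iff] at ht ⊢
      rw [norm_mul, Real.norm_of_nonneg hs.1]
      exact (mul_le_of_le_one_right (norm_nonneg t) hs.2).trans_lt ht
    have hcU : ∀ k, c ((t : ℂ), y t) k ∈ U := by
      intro k
      rw [hc]
      simpa [y] using (hball _ (htk k k.2)).2
    ext k
    have hi : primitiveOp (superpose Φ (c ((t : ℂ), y t))) k
        = ∫ s in (0 : ℝ)..k, Φ (((t * s : ℝ) : ℂ), V (t * s)) := by
      rw [primitiveOp_apply]
      refine intervalIntegral.integral_congr fun s hs => ?_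
      rw [uIcc_of_le k.2.1] at hs
      have hs' : s ∈ Icc (0 : ℝ) 1 := ⟨hs.1, hs.2.trans k.2.2⟩
      simp only [superpose_apply hΦU.continuousOn hcU, hc, projIcc_of_mem zero_le_one hs']
      simp [y]
    have hsm := intervalIntegral.smul_integral_comp_mul_left (a := 0) (b := (k : ℝ))
      (fun r : ℝ => Φ ((r : ℂ), V r)) t
    have hVt := (hball _ (htk k k.2)).1
    simp only [f, ContinuousMap.sub_apply, ContinuousMap.smul_apply, hi, ContinuousMap.zero_apply]
    rw [mul_zero] at hsm
    have hts : (t : ℂ) • (∫ s in (0 : ℝ)..k, Φ (((t * s : ℝ) : ℂ), V (t * s)))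
        = t • ∫ s in (0 : ℝ)..k, Φ (((t * s : ℝ) : ℂ), V (t * s)) := Complex.coe_smul _ _
    rw [hts, hsm]
    simp only [y, ContinuousMap.coe_mk]
    rw [hVt]
    abel
  refine ⟨fun z => V 0 + ψ z ⟨1, by simp⟩, ?_, ?_, ?_⟩
  · have h1 := hψ.continuousLinearMap_comp
      (ContinuousMap.evalCLM ℂ (⟨1, by simp⟩ : Icc (0 : ℝ) 1) : C(Icc (0 : ℝ) 1, Z) →L[ℂ] Z)
    exact contDiffAt_const.add h1
  · simp [hψ0]
  · have h00 : f (0, 0) = 0 := by simp [f]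
    filter_upwards [hlim.eventually huniq, Metric.ball_mem_nhds _ hρ] with t h1 h2
    rw [h1 (by rw [hsol t h2, h00])]
    simp [y]

/-- A function of a real variable that is the image of a holomorphic function under a bounded
real-linear map is real analytic. -/
theorem analyticAt_of_contDiffAt_complex [CompleteSpace Z] {E : Type*} [NormedAddCommGroup E]
    [NormedSpace ℝ E] {g : ℂ → Z} (hg : ContDiffAt ℂ 1 g 0) (p : Z →L[ℝ] E)
    {φ : ℝ → E} (h : ∀ᶠ t : ℝ in 𝓝 0, p (g t) = φ t) : AnalyticAt ℝ φ 0 := by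
  have h1 : AnalyticAt ℂ g 0 := by
    rw [Complex.analyticAt_iff_eventually_differentiableAt]
    filter_upwards [hg.eventually (by simp)] with z hz
    exact hz.differentiableAt one_ne_zero
  have h2 : AnalyticAt ℝ (fun t : ℝ => g t) 0 := by
    have := h1.restrictScalars (𝕜 := ℝ)
    refine AnalyticAt.fun_comp (f := fun t : ℝ => (t : ℂ)) (g := g) (by simpa using this)
      (Complex.ofRealCLM.analyticAt 0)
  exact ((p.analyticAt _).fun_comp h2).congr h

end HolomorphicODE

/-! ### Complexification of operators on paths -/

section ComplexifiedPaths

open Filter Topology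

variable {E F : Type*} [NormedAddCommGroup E] [InnerProductSpace ℝ E]
  [NormedAddCommGroup F] [InnerProductSpace ℝ F]

instance [CompleteSpace E] : CompleteSpace (Complexified E) :=
  inferInstanceAs (CompleteSpace (WithLp 2 (E × E)))

namespace Complexified

theorem norm_re_le (z : Complexified E) : ‖z.re‖ ≤ ‖z‖ :=
  abs_le_of_sq_le_sq' (by rw [norm_sq]; nlinarith [sq_nonneg ‖z.im‖]) (norm_nonneg z) |>.2

theorem norm_im_le (z : Complexified E) : ‖z.im‖ ≤ ‖z‖ :=
  abs_le_of_sq_le_sq' (by rw [norm_sq]; nlinarith [sq_nonneg ‖z.re‖]) (norm_nonneg z) |>.2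

@[simp] theorem re_ofReal (x : E) : (ofReal x).re = x := rfl
@[simp] theorem im_ofReal (x : E) : (ofReal x).im = 0 := rfl

@[simp] theorem re_real_smul (r : ℝ) (z : Complexified E) : (r • z).re = r • z.re :=
  (re_smul (r : ℂ) z).trans (by simp)

@[simp] theorem im_real_smul (r : ℝ) (z : Complexified E) : (r • z).im = r • z.im :=
  (im_smul (r : ℂ) z).trans (by simp)

/-- The real part as a bounded real-linear operator. -/
def reL : Complexified E →L[ℝ] E :=
  LinearMap.mkContinuous ⟨⟨re, re_add⟩, re_real_smul⟩ 1
    (fun z => by simpa using norm_re_le z)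

/-- The imaginary part as a bounded real-linear operator. -/
def imL : Complexified E →L[ℝ] E :=
  LinearMap.mkContinuous ⟨⟨im, im_add⟩, im_real_smul⟩ 1
    (fun z => by simpa using norm_im_le z)

/-- The embedding `x ↦ x + i0` as a bounded real-linear operator. -/
def ofRealL : E →L[ℝ] Complexified E :=
  LinearMap.mkContinuous
    ⟨⟨ofReal, fun x y => by apply ext <;> simp⟩, fun r x => by
      apply ext
      · simp
      · simp⟩ 1
    (fun x => by
      have h := norm_sq (ofReal x)
      simp only [re_ofReal, im_ofReal, norm_zero] at h
      have : ‖ofReal x‖ = ‖x‖ := by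
        rw [← sq_eq_sq₀ (norm_nonneg _) (norm_nonneg _), h]; ring
      simpa using this.le)

@[simp] theorem reL_apply (z : Complexified E) : reL z = z.re := rfl
@[simp] theorem imL_apply (z : Complexified E) : imL z = z.im := rfl
@[simp] theorem ofRealL_apply (x : E) : ofRealL x = ofReal x := rfl

@[simp] theorem re_sub (z w : Complexified E) : (z - w).re = z.re - w.re := map_sub reL z w
@[simp] theorem im_sub (z w : Complexified E) : (z - w).im = z.im - w.im := map_sub imL z w

end Complexified

open Complexified

variable {J : Type*} [TopologicalSpace J]

/-- The operator `y ↦ L ∘ y` on paths. -/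
def pathMap {E F : Type*} [NormedAddCommGroup E] [NormedSpace ℝ E] [NormedAddCommGroup F]
    [NormedSpace ℝ F] (L : E →L[ℝ] F) : C(J, E) →L[ℝ] C(J, F) :=
  L.compLeftContinuous ℝ J

@[simp] theorem pathMap_apply {E F : Type*} [NormedAddCommGroup E] [NormedSpace ℝ E]
    [NormedAddCommGroup F] [NormedSpace ℝ F] (L : E →L[ℝ] F) (y : C(J, E)) (t : J) :
    pathMap L y t = L (y t) := rfl

/-- The path `t ↦ y(t) + i0`. -/
def ofRealPath : C(J, E) →L[ℝ] C(J, Complexified E) := pathMap ofRealL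

@[simp] theorem ofRealPath_apply (y : C(J, E)) (t : J) : ofRealPath y t = ofReal (y t) := rfl

variable [CompactSpace J]

/-- The complex-linear extension of a real-linear operator on paths. -/
def complexifyPath (L : C(J, E) →L[ℝ] C(J, F)) :
    C(J, Complexified E) →L[ℂ] C(J, Complexified F) where
  toFun y := ofRealPath (L (pathMap reL y))
    + Complex.I • ofRealPath (L (pathMap imL y))
  map_add' y z := by
    simp only [map_add, smul_add]
    abel
  map_smul' c y := by
    have h1 : pathMap reL (c • y)
        = c.re • pathMap reL y - c.im • pathMap imL y := by
      ext t; simp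
    have h2 : pathMap imL (c • y)
        = c.im • pathMap reL y + c.re • pathMap imL y := by
      ext t; simp
    rw [h1, h2]
    ext t
    apply Complexified.ext <;> simp
    abel
  cont := by fun_prop

theorem complexifyPath_ofRealPath (L : C(J, E) →L[ℝ] C(J, F)) (y : C(J, E)) :
    complexifyPath L (ofRealPath y) = ofRealPath (L y) := by
  have h1 : pathMap reL (ofRealPath y) = y := by ext t; simp
  have h2 : pathMap imL (ofRealPath y) = 0 := by ext t; simp
  show ofRealPath (L (pathMap reL (ofRealPath y)))
    + Complex.I • ofRealPath (L (pathMap imL (ofRealPath y))) = _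
  rw [h1, h2]
  simp

theorem ofReal_mem_interior_cylinder {M δ : ℝ} (hδ : 0 < δ) {x : E} (hx : ‖x‖ < M) :
    ofReal x ∈ interior (cylinder E M δ) := by
  refine mem_interior.2 ⟨{z | ‖z.re‖ < M ∧ ‖z.im‖ < δ}, fun z hz => ⟨hz.1.le, hz.2.le⟩, ?_, ?_⟩
  · exact (isOpen_lt (reL.continuous.norm) continuous_const).inter
      (isOpen_lt (imL.continuous.norm) continuous_const)
  · simpa using ⟨hx, hδ⟩

/-- On real vectors the complex derivative of a holomorphic extension is the real derivative. -/
theorem fderiv_ofReal_apply {f : E → E} {G : Complexified E → Complexified E} {x : E}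
    (hfG : ∀ᶠ y in 𝓝 x, G (ofReal y) = ofReal (f y)) (hf : DifferentiableAt ℝ f x)
    (hG : DifferentiableAt ℂ G (ofReal x)) (h : E) :
    fderiv ℂ G (ofReal x) (ofReal h) = ofReal (fderiv ℝ f x h) := by
  have h1 : HasFDerivAt (fun y => G (ofReal y))
      (((fderiv ℂ G (ofReal x)).restrictScalars ℝ).comp ofRealL) x :=
    HasFDerivAt.comp (g := G) x (hG.hasFDerivAt.restrictScalars ℝ) ofRealL.hasFDerivAt
  have h2 : HasFDerivAt (fun y => ofReal (f y)) (ofRealL.comp (fderiv ℝ f x)) x :=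
    ofRealL.hasFDerivAt.comp x hf.hasFDerivAt
  exact congrArg (fun L : E →L[ℝ] Complexified E => L h)
    ((h1.congr_of_eventuallyEq (hfG.mono fun y hy => hy.symm)).unique h2)

end ComplexifiedPaths

/-! ### Duhamel and Volterra operators -/

section Duhamel

open Filter Topology MeasureTheory

variable {E : Type*} [NormedAddCommGroup E] [NormedSpace ℝ E]

/-- A strongly continuous one-parameter group of isometries. -/
structure IsIsometryGroup (G : ℝ → E →L[ℝ] E) : Prop where
  map_zero : G 0 = ContinuousLinearMap.id ℝ E
  map_add : ∀ s t, G (s + t) = (G s).comp (G t)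
  continuous : ∀ x, Continuous fun t => G t x
  norm_map : ∀ t x, ‖G t x‖ = ‖x‖

namespace IsIsometryGroup

variable {G : ℝ → E →L[ℝ] E} (hG : IsIsometryGroup G)
include hG

theorem apply_add (s t : ℝ) (x : E) : G (s + t) x = G s (G t x) := by
  rw [hG.map_add]; rfl

theorem continuous_apply {α : Type*} [TopologicalSpace α] {a : α → ℝ} {x : α → E}
    (ha : Continuous a) (hx : Continuous x) : Continuous fun p => G (a p) (x p) := by
  have h : Continuous fun p : ℝ × E => G p.1 p.2 := by
    refine continuous_prod_of_continuous_lipschitzWith' (fun p : ℝ × E => G p.1 p.2) 1 ?_ ?_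
    · exact fun t => LipschitzWith.of_dist_le_mul fun x y => by
        simp [dist_eq_norm, ← map_sub, hG.norm_map]
    · exact hG.continuous
  exact h.comp (ha.prodMk hx)

theorem continuous_integral {T : ℝ} {x : ℝ → E} (hx : Continuous x) :
    Continuous fun t : Icc 0 T => ∫ s in (0 : ℝ)..t, G (t - s) (x s) := by
  have h := intervalIntegral.continuous_parametric_intervalIntegral_of_continuous
    (f := fun (t : Icc 0 T) s => G (t - s) (x s)) (a₀ := 0) (s := fun t => t)
    (μ := volume) ?_ continuous_subtype_val
  · exact h
  · exact hG.continuous_apply (by fun_prop) (by fun_prop)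

theorem intervalIntegrable {x : ℝ → E} (hx : Continuous x) (t a b : ℝ) :
    IntervalIntegrable (fun s => G (t - s) (x s)) volume a b :=
  (hG.continuous_apply (by fun_prop) hx).intervalIntegrable a b

end IsIsometryGroup

section

variable {G : ℝ → E →L[ℝ] E} (hG : IsIsometryGroup G) {T : ℝ} (hT : 0 ≤ T)

/-- The Duhamel operator `g ↦ ∫₀ᵗ G(t-s) g(s) ds` on `C([0,T], E)`. -/
def duhamel : C(Icc 0 T, E) →L[ℝ] C(Icc 0 T, E) :=
  LinearMap.mkContinuous
    { toFun := fun g => ⟨fun t => ∫ s in (0 : ℝ)..t, G (t - s) (g (projIcc 0 T hT s)),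
        hG.continuous_integral (g.continuous.comp continuous_projIcc)⟩
      map_add' := fun g h => by
        ext t
        simp only [ContinuousMap.coe_mk, ContinuousMap.add_apply, _root_.map_add]
        exact intervalIntegral.integral_add
          (hG.intervalIntegrable (g.continuous.comp continuous_projIcc) _ _ _)
          (hG.intervalIntegrable (h.continuous.comp continuous_projIcc) _ _ _)
      map_smul' := fun c g => by
        ext t
        simp only [ContinuousMap.coe_mk, ContinuousMap.smul_apply, map_smul]
        exact intervalIntegral.integral_smul c _ } T (fun g => by
    rw [ContinuousMap.norm_le _ (mul_nonneg hT (norm_nonneg g))]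
    intro t
    refine (intervalIntegral.norm_integral_le_of_norm_le_const (C := ‖g‖) fun s _ => ?_).trans ?_
    · rw [hG.norm_map]; exact g.norm_coe_le_norm _
    · rw [sub_zero, abs_of_nonneg t.2.1, mul_comm]
      exact mul_le_mul_of_nonneg_right t.2.2 (norm_nonneg g))

theorem duhamel_apply (g : C(Icc 0 T, E)) (t : Icc 0 T) :
    duhamel hG hT g t = ∫ s in (0 : ℝ)..t, G (t - s) (g (projIcc 0 T hT s)) := rfl

theorem norm_duhamel_apply_le (g : C(Icc 0 T, E)) (t : Icc 0 T) :
    ‖duhamel hG hT g t‖ ≤ ∫ s in (0 : ℝ)..t, ‖g (projIcc 0 T hT s)‖ := by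
  refine (intervalIntegral.norm_integral_le_integral_norm t.2.1).trans_eq ?_
  simp only [hG.norm_map]

/-- The free evolution `x ↦ (t ↦ G(t) x)`. -/
def freeEvolution (T : ℝ) : E →L[ℝ] C(Icc 0 T, E) :=
  LinearMap.mkContinuous
    { toFun := fun x => ⟨fun t => G t x, (hG.continuous x).comp continuous_subtype_val⟩
      map_add' := fun x y => by ext t; simp
      map_smul' := fun c x => by ext t; simp } 1 (fun x => by
    rw [ContinuousMap.norm_le _ (by positivity)]
    intro t
    simp [hG.norm_map])

@[simp] theorem freeEvolution_apply (x : E) (t : Icc 0 T) : freeEvolution hG T x t = G t x := rfl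

/-- A causal operator `N` on `C([0,T], E)` with `‖(N w)(t)‖ ≤ m ∫₀ᵗ ‖w‖` makes `1 - N` invertible,
because `‖N^k‖ ≤ (mT)^k / k!`. -/
theorem isUnit_one_sub_of_causal [CompleteSpace E] {N : C(Icc 0 T, E) →L[ℝ] C(Icc 0 T, E)} {m : ℝ}
    (hm : 0 ≤ m)
    (hN : ∀ w (t : Icc 0 T), ‖N w t‖ ≤ m * ∫ s in (0 : ℝ)..t, ‖w (projIcc 0 T hT s)‖) :
    IsUnit (1 - N) := by
  have hpow : ∀ (k : ℕ) (w : C(Icc 0 T, E)) (t : Icc 0 T),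
      ‖(N ^ k) w t‖ ≤ m ^ k * (t : ℝ) ^ k / k.factorial * ‖w‖ := by
    intro k
    induction k with
    | zero => intro w t; simpa using w.norm_coe_le_norm t
    | succ k ih =>
      intro w t
      rw [pow_succ', mul_apply_eq_comp]
      refine (hN _ t).trans ?_
      have hle : (∫ s in (0 : ℝ)..t, ‖(N ^ k) w (projIcc 0 T hT s)‖)
          ≤ ∫ s in (0 : ℝ)..t, m ^ k * s ^ k / k.factorial * ‖w‖ := by
        refine intervalIntegral.integral_mono_on t.2.1 ?_ ?_ fun s hs => ?_
        · exact (((N ^ k) w).continuous.comp continuous_projIcc).norm.intervalIntegrable _ _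
        · exact Continuous.intervalIntegrable (by fun_prop) _ _
        · have := ih w (projIcc 0 T hT s)
          rwa [projIcc_of_mem hT ⟨hs.1, hs.2.trans t.2.2⟩] at this ⊢
      refine (mul_le_mul_of_nonneg_left hle hm).trans_eq ?_
      have hi : (∫ s in (0 : ℝ)..t, m ^ k * s ^ k / k.factorial * ‖w‖)
          = m ^ k / k.factorial * ‖w‖ * ((t : ℝ) ^ (k + 1) / (k + 1)) := by
        have hp : (∫ s in (0 : ℝ)..t, s ^ k) = (t : ℝ) ^ (k + 1) / (k + 1) := by simp
        rw [← hp, ← intervalIntegral.integral_const_mul]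
        congr 1
        ext s
        ring
      rw [hi, Nat.factorial_succ]
      push_cast
      field_simp
      ring
  obtain ⟨k, hk⟩ := ((FloorSemiring.tendsto_pow_div_factorial_atTop (m * T)).eventually_lt_const
    (zero_lt_one' ℝ)).exists
  have hnorm : ‖N ^ k‖ < 1 := by
    refine lt_of_le_of_lt (ContinuousLinearMap.opNorm_le_bound _ ?_ fun w => ?_) hk
    · positivity
    · rw [ContinuousMap.norm_le _ (by positivity)]
      intro t
      refine (hpow k w t).trans ?_
      have := t.2.1
      rw [mul_pow]
      gcongr
      exact t.2.2
  have hu : IsUnit (1 - N ^ k) :=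
    isUnit_one_sub_of_norm_lt_one (R := C(Icc 0 T, E) →L[ℝ] C(Icc 0 T, E)) hnorm
  have hc : Commute (∑ i ∈ Finset.range k, N ^ i) (1 - N) :=
    (Commute.one_right _).sub_right
      (Commute.sum_left _ _ _ fun i _ => (Commute.refl N).pow_left i)
  rw [← geom_sum_mul_neg, hc.isUnit_mul_iff] at hu
  exact hu.2

end

end Duhamel

/-! ### Reconstruction of high-frequency solutions from their observation -/

section Reconstruction

open Filter Topology MeasureTheory

/-- An operator into a Hilbert space that is bounded below has a bounded left inverse. -/
theorem ContinuousLinearMap.hasLeftInverse_of_norm_le {E H : Type*} [NormedAddCommGroup E]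
    [NormedSpace ℝ E] [CompleteSpace E] [NormedAddCommGroup H] [InnerProductSpace ℝ H]
    [CompleteSpace H] (L : E →L[ℝ] H) (c : NNReal) (h : ∀ x, ‖x‖ ≤ c * ‖L x‖) :
    L.HasLeftInverse := by
  have ha : AntilipschitzWith c L := L.antilipschitz_of_bound h
  have hcl : IsClosed (range L) := ha.isClosed_range L.uniformContinuous
  have : CompleteSpace L.range := (show IsClosed (L.range : Set H) from hcl).completeSpace_coe
  exact .of_injective_of_isClosed_range_of_closedComplement_range ha.injective hcl
    ⟨L.range.orthogonalProjectionOnto, fun x =>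
      Submodule.orthogonalProjectionOnto_mem_subspace_eq_self x⟩

/-- The Lebesgue measure on `[0,T]`. -/
def pathMeasure (T : ℝ) : Measure (Icc 0 T) := volume.comap Subtype.val

instance (T : ℝ) : IsFiniteMeasure (pathMeasure T) where
  measure_univ_lt_top := by
    rw [pathMeasure, comap_subtype_coe_apply measurableSet_Icc, image_univ, Subtype.range_coe,
      Real.volume_Icc]
    exact ENNReal.ofReal_lt_top

theorem norm_toLp_sq {E : Type*} [NormedAddCommGroup E] [InnerProductSpace ℝ E] {T : ℝ}
    (hT : 0 ≤ T) (y : C(Icc 0 T, E)) :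
    ‖ContinuousMap.toLp 2 (pathMeasure T) ℝ y‖ ^ 2
      = ∫ t in (0 : ℝ)..T, ‖y (projIcc 0 T hT t)‖ ^ 2 := by
  rw [← real_inner_self_eq_norm_sq, L2.inner_def]
  have h1 : (∫ t, inner ℝ (ContinuousMap.toLp 2 (pathMeasure T) ℝ y t)
      (ContinuousMap.toLp 2 (pathMeasure T) ℝ y t) ∂(pathMeasure T))
      = ∫ t : Icc 0 T, ‖y (projIcc 0 T hT t)‖ ^ 2 ∂(pathMeasure T) := by
    refine integral_congr_ae ?_
    filter_upwards [ContinuousMap.coeFn_toLp (𝕜 := ℝ) (p := 2) (pathMeasure T) y] with t ht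
    rw [ht, projIcc_val, real_inner_self_eq_norm_sq]
  rw [h1, pathMeasure, integral_subtype_comap measurableSet_Icc fun t => ‖y (projIcc 0 T hT t)‖ ^ 2,
    integral_Icc_eq_integral_Ioc, intervalIntegral.integral_of_le hT]

/-- Reconstruction from the observation. If the homogeneous equation
`w(t) = G(t) w(0) + ∫₀ᵗ G(t-s) M(s) w(s) ds` in the range of the projection `Q` is observable
through `C`, then the solution of the equation with source `g` is a bounded linear function of the
pair `(C w, g)`. -/
theorem exists_reconstruction {E : Type*} [NormedAddCommGroup E] [InnerProductSpace ℝ E]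
    [CompleteSpace E] {G : ℝ → E →L[ℝ] E} (hG : IsIsometryGroup G) {T : ℝ} (hT : 0 ≤ T)
    (Q C : E →L[ℝ] E) (hQG : ∀ t x, Q (G t x) = G t (Q x))
    (M : C(Icc 0 T, E →L[ℝ] E)) (hQM : ∀ t x, Q (M t x) = M t x) {c : ℝ} (hc : 0 < c)
    (hobs : ∀ w : C(Icc 0 T, E), (∀ t, Q (w t) = w t) →
      (∀ t, w t = G t (w ⟨0, left_mem_Icc.2 hT⟩) + duhamel hG hT (mulOp M w) t) →
      ‖w ⟨0, left_mem_Icc.2 hT⟩‖ ^ 2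
        ≤ c ^ 2 * ∫ t in (0 : ℝ)..T, ‖C (w (projIcc 0 T hT t))‖ ^ 2) :
    ∃ Θ₁ Θ₂ : C(Icc 0 T, E) →L[ℝ] C(Icc 0 T, E), ∀ w g : C(Icc 0 T, E),
      (∀ t, Q (w t) = w t) →
      (∀ t, w t = G t (w ⟨0, left_mem_Icc.2 hT⟩) + duhamel hG hT (mulOp M w + g) t) →
      w = Θ₁ (pathMap C w) + Θ₂ g := by
  set o : Icc 0 T := ⟨0, left_mem_Icc.2 hT⟩
  set D := duhamel hG hT
  set S := freeEvolution hG T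
  -- `R` solves the Volterra equation `y = w + D M y`, which is uniquely solvable for every `w`
  have hunit : IsUnit (1 - D.comp (mulOp M)) := by
    refine isUnit_one_sub_of_causal hT (norm_nonneg M) fun w t => ?_
    refine (norm_duhamel_apply_le hG hT _ t).trans ?_
    rw [← intervalIntegral.integral_const_mul]
    refine intervalIntegral.integral_mono_on t.2.1 ?_ ?_ fun s _ => ?_
    · exact ((mulOp M w).continuous.comp continuous_projIcc).norm.intervalIntegrable _ _
    · exact ((w.continuous.comp continuous_projIcc).norm.const_mul _).intervalIntegrable _ _
    · exact (M _).le_of_opNorm_le (M.norm_coe_le_norm _) _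
  obtain ⟨R, hR1, hR2⟩ : ∃ R : C(Icc 0 T, E) →L[ℝ] C(Icc 0 T, E),
      (1 - D.comp (mulOp M)) * R = 1 ∧ R * (1 - D.comp (mulOp M)) = 1 :=
    ⟨↑hunit.unit⁻¹, hunit.mul_val_inv, hunit.val_inv_mul⟩
  have hR1' : ∀ y, R y = y + D (mulOp M (R y)) := fun y => by
    have := congrArg (fun L : C(Icc 0 T, E) →L[ℝ] C(Icc 0 T, E) => L y) hR1
    simp only [mul_apply_eq_comp, sub_apply, one_apply_eq_self,
      ContinuousLinearMap.comp_apply] at this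
    exact sub_eq_iff_eq_add.1 this
  have hR2' : ∀ y, R (y - D (mulOp M y)) = y := fun y =>
    congrArg (fun L : C(Icc 0 T, E) →L[ℝ] C(Icc 0 T, E) => L y) hR2
  have hQD : ∀ (y : C(Icc 0 T, E)) t, (∀ s, Q (y s) = y s) → Q (D y t) = D y t := by
    intro y t hy
    have hi := (hG.intervalIntegrable (y.continuous.comp (continuous_projIcc (h := hT))) t 0 t)
    show Q (∫ s in (0 : ℝ)..t, G (t - s) (y (projIcc 0 T hT s))) = _
    rw [← Q.intervalIntegral_comp_comm (by exact hi)]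
    simp only [hQG, hy]
    rfl
  -- solutions of the homogeneous equation with initial value in the range of `Q`
  have hhom : ∀ x, Q x = x → (∀ t, Q (R (S x) t) = R (S x) t) ∧ R (S x) o = x ∧
      ∀ t, R (S x) t = G t x + D (mulOp M (R (S x))) t := by
    intro x hx
    have h1 : ∀ t, R (S x) t = G t x + D (mulOp M (R (S x))) t := fun t =>
      congrArg (fun y : C(Icc 0 T, E) => y t) (hR1' (S x))
    refine ⟨fun t => ?_, ?_, h1⟩
    · rw [h1 t, map_add, hQG, hx, hQD _ t fun s => hQM s _]
    · rw [h1 o]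
      have : D (mulOp M (R (S x))) o = 0 := by
        show ∫ s in (0 : ℝ)..(0 : ℝ), _ = _
        simp
      rw [this, add_zero]
      show G 0 x = x
      rw [hG.map_zero]; rfl
  let V : Submodule ℝ E := LinearMap.ker ((1 - Q : E →L[ℝ] E) : E →ₗ[ℝ] E)
  have hV : ∀ x, x ∈ V ↔ Q x = x := fun x => by
    simp only [V, LinearMap.mem_ker, ContinuousLinearMap.coe_coe, sub_apply,
      one_apply_eq_self, sub_eq_zero]
    exact eq_comm
  have hVc : CompleteSpace V :=
    ((1 - Q : E →L[ℝ] E).isClosed_ker).completeSpace_coe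
  -- the observation map on initial values, which observability makes bounded below
  let P2 := ContinuousMap.toLp (E := E) 2 (pathMeasure T) ℝ
  let Λ : V →L[ℝ] Lp E 2 (pathMeasure T) :=
    P2.comp ((pathMap C).comp (R.comp (S.comp V.subtypeL)))
  obtain ⟨Γ, hΓ⟩ : Λ.HasLeftInverse := by
    refine Λ.hasLeftInverse_of_norm_le ⟨c, hc.le⟩ fun x => ?_
    have hx := (hV x).1 x.2
    obtain ⟨h1, h2, h3⟩ := hhom x hx
    have h4 := hobs (R (S x)) h1 (by rw [h2]; exact h3)
    rw [h2] at h4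
    have h5 : ‖Λ x‖ ^ 2 = ∫ t in (0 : ℝ)..T, ‖C (R (S x) (projIcc 0 T hT t))‖ ^ 2 :=
      norm_toLp_sq hT _
    rw [← h5, ← mul_pow] at h4
    exact abs_le_of_sq_le_sq' h4 (mul_nonneg hc.le (norm_nonneg _)) |>.2
  let Θ : C(Icc 0 T, E) →L[ℝ] C(Icc 0 T, E) := R.comp (S.comp (V.subtypeL.comp (Γ.comp P2)))
  -- remove the part `R D g` due to the source, and reconstruct the homogeneous part
  refine ⟨Θ, R.comp D - Θ.comp ((pathMap C).comp (R.comp D)), fun w g hw hwg => ?_⟩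
  have h1 : w = R (S (w o)) + R (D g) := by
    rw [← map_add, ← hR2' w]
    congr 1
    ext t
    simp only [ContinuousMap.sub_apply, ContinuousMap.add_apply]
    rw [hR2' w]
    conv_lhs => rw [hwg t]
    rw [map_add]
    simp only [ContinuousMap.add_apply, S, freeEvolution_apply]
    abel
  have h2 : ((Γ (P2 (pathMap C (R (S (w o)))))) : E) = w o :=
    congrArg Subtype.val (hΓ ⟨w o, (hV _).2 (hw o)⟩)
  have h3 : Θ (pathMap C (R (S (w o)))) = R (S (w o)) := by
    show R (S ((Γ (P2 (pathMap C (R (S (w o)))))) : E)) = _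
    rw [h2]
  conv_lhs => rw [h1]
  conv_rhs => rw [h1]
  simp only [map_add, h3, sub_apply, ContinuousLinearMap.comp_apply]
  abel

end Reconstruction

/-! ### Analyticity for coupled low-frequency and high-frequency systems -/

section CoupledSystem

open Filter Topology MeasureTheory

/-- The mechanism behind the analyticity of observed solutions. The high-frequency part `W` is
determined by the low-frequency part `V` through the equation
`W = -K V + L (N(V + W + h₁) + h₂ - N' W)`, whose partial derivative in `W` is the identity because
`N'` is the derivative of `N` at the base point; so `W` is a holomorphic function of `(t, V)`.
Substituting it turns the equation of `V` into a holomorphic differential equation. -/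
theorem exists_contDiffAt_of_coupled_system {Z : Type*} [NormedAddCommGroup Z] [NormedSpace ℂ Z]
    [CompleteSpace Z] {N : Z → Z} {N' K L B P : Z →L[ℂ] Z} {h₁ h₂ : ℂ → Z} {V W v : ℝ → Z}
    (hV : Continuous V) (hW : Continuous W)
    (hN : ContDiffAt ℂ 1 N (V 0 + W 0 + h₁ 0)) (hN' : HasFDerivAt N N' (V 0 + W 0 + h₁ 0))
    (hh₁ : ContDiffAt ℂ 1 h₁ 0) (hh₂ : ContDiffAt ℂ 1 h₂ 0)
    (hWeq : ∀ᶠ t : ℝ in 𝓝 0, W t = -K (V t) + L (N (V t + W t + h₁ t) + h₂ t - N' (W t)))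
    (hVeq : ∀ᶠ t : ℝ in 𝓝 0, V t = V 0 + ∫ r in (0 : ℝ)..t, v r)
    (hv : ∀ᶠ t : ℝ in 𝓝 0, v t = B (V t + W t) + P (N (V t + W t + h₁ t) + h₂ t)) :
    ∃ g : ℂ → Z, ContDiffAt ℂ 1 g 0 ∧ ∀ᶠ t : ℝ in 𝓝 0, g t = V t + W t := by
  let f : (ℂ × Z) × Z → Z := fun p =>
    p.2 - (-K p.1.2 + L (N (p.1.2 + p.2 + h₁ p.1.1) + h₂ p.1.1 - N' p.2))
  have hf : ContDiffAt ℂ 1 f ((0, V 0), W 0) := by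
    have e1 : ContDiffAt ℂ 1 (fun p : (ℂ × Z) × Z => h₁ p.1.1) ((0, V 0), W 0) :=
      ContDiffAt.comp (g := h₁) _ hh₁ (contDiff_fst.fst.contDiffAt)
    have e2 : ContDiffAt ℂ 1 (fun p : (ℂ × Z) × Z => h₂ p.1.1) ((0, V 0), W 0) :=
      ContDiffAt.comp (g := h₂) _ hh₂ (contDiff_fst.fst.contDiffAt)
    have e3 : ContDiffAt ℂ 1 (fun p : (ℂ × Z) × Z => N (p.1.2 + p.2 + h₁ p.1.1))
        ((0, V 0), W 0) :=
      ContDiffAt.comp (g := N) (f := fun p : (ℂ × Z) × Z => p.1.2 + p.2 + h₁ p.1.1) _ hN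
        ((contDiff_fst.snd.contDiffAt.add contDiffAt_snd).add e1)
    have e4 := ((e3.add e2).sub (contDiffAt_snd.continuousLinearMap_comp N'))
    have e5 : ContDiffAt ℂ 1 (fun p : (ℂ × Z) × Z => K p.1.2) ((0, V 0), W 0) :=
      (K.contDiff.comp contDiff_fst.snd).contDiffAt
    exact contDiffAt_snd.sub (e5.neg.add (e4.continuousLinearMap_comp L))
  have hf2 : HasFDerivAt (fun w => f ((0, V 0), w)) (ContinuousLinearMap.id ℂ Z) (W 0) := by
    have e1 : HasFDerivAt (fun w => N (V 0 + w + h₁ 0)) N' (W 0) := by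
      exact (hN'.comp (f := fun w => V 0 + w + h₁ 0) (f' := ContinuousLinearMap.id ℂ Z) (W 0)
        (((hasFDerivAt_id (W 0)).const_add (V 0)).add_const (h₁ 0))).congr_fderiv
          N'.comp_id
    have e2 := L.hasFDerivAt.comp (W 0) ((e1.add_const (h₂ 0)).sub N'.hasFDerivAt)
    have e3 := (hasFDerivAt_id (𝕜 := ℂ) (W 0)).sub (e2.const_add (-K (V 0)))
    exact e3.congr_fderiv (by simp)
  obtain ⟨R, hR0, hR, hRuniq⟩ := exists_implicitFunction hf hf2
  have hzero : ∀ᶠ t : ℝ in 𝓝 0, f (((t : ℂ), V t), W t) = 0 := by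
    filter_upwards [hWeq] with t ht
    exact sub_eq_zero.2 ht
  have hf0 : f ((0, V 0), W 0) = 0 := by simpa using hzero.self_of_nhds
  have hRW : ∀ᶠ t : ℝ in 𝓝 0, R ((t : ℂ), V t) = W t := by
    have hlim : Tendsto (fun t : ℝ => (((t : ℂ), V t), W t)) (𝓝 0) (𝓝 ((0, V 0), W 0)) := by
      have : Continuous fun t : ℝ => (((t : ℂ), V t), W t) := by fun_prop
      simpa using this.tendsto 0
    filter_upwards [hlim.eventually hRuniq, hzero] with t h1 h2
    exact h1 (h2.trans hf0.symm)
  let Φ : ℂ × Z → Z := fun p => B (p.2 + R p) + P (N (p.2 + R p + h₁ p.1) + h₂ p.1)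
  have hΦ : ContDiffAt ℂ 1 Φ (0, V 0) := by
    have e0 := contDiffAt_snd.add hR
    have e1 : ContDiffAt ℂ 1 (fun p : ℂ × Z => h₁ p.1) (0, V 0) :=
      ContDiffAt.comp (g := h₁) _ hh₁ contDiffAt_fst
    have e2 : ContDiffAt ℂ 1 (fun p : ℂ × Z => h₂ p.1) (0, V 0) :=
      ContDiffAt.comp (g := h₂) _ hh₂ contDiffAt_fst
    have e3 : ContDiffAt ℂ 1 (fun p : ℂ × Z => N (p.2 + R p + h₁ p.1)) (0, V 0) := by
      refine ContDiffAt.comp (g := N) (f := fun p : ℂ × Z => p.2 + R p + h₁ p.1) _ ?_ (e0.add e1)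
      simpa [hR0] using hN
    exact (e0.continuousLinearMap_comp B).add ((e3.add e2).continuousLinearMap_comp P)
  have hint : ∀ᶠ t : ℝ in 𝓝 0, V t = V 0 + ∫ r in (0 : ℝ)..t, Φ (r, V r) := by
    obtain ⟨ρ, hρ, hball⟩ := Metric.eventually_nhds_iff_ball.1 (hVeq.and (hv.and hRW))
    filter_upwards [Metric.ball_mem_nhds _ hρ] with t ht
    rw [(hball t ht).1, intervalIntegral.integral_congr fun r hr => ?_]
    have hr' : r ∈ Metric.ball (0 : ℝ) ρ :=
      (convex_ball (0 : ℝ) ρ).ordConnected.uIcc_subset (Metric.mem_ball_self hρ) ht hr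
    simp only [Φ, (hball r hr').2.1, (hball r hr').2.2]
  obtain ⟨ψ, hψ, hψ0, hψV⟩ := exists_contDiffAt_of_integral_eq hV hΦ hint
  refine ⟨fun z => ψ z + R (z, ψ z), ?_, ?_⟩
  · refine hψ.add (ContDiffAt.comp (g := R) (f := fun z => (z, ψ z)) _ ?_
      (contDiffAt_id.prodMk hψ))
    rwa [hψ0]
  · filter_upwards [hψV, hRW] with t h1 h2
    rw [h1, h2]

end CoupledSystem

/-! ### Mild solutions: time translation and low frequencies -/

section MildSolutions

open Filter Topology MeasureTheory

variable {E : Type*} [NormedAddCommGroup E] [NormedSpace ℝ E] [CompleteSpace E]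
  {G : ℝ → E →L[ℝ] E} (hG : IsIsometryGroup G) {S : ℝ} {u g : ℝ → E} (hg : Continuous g)
  (hu : ∀ t ∈ Icc 0 S, u t = G t (u 0) + ∫ s in (0 : ℝ)..t, G (t - s) (g s))
include hG hg hu

theorem mild_solution_translate {t s : ℝ} (ht : 0 ≤ t) (hs : 0 ≤ s) (hts : t + s ≤ S) :
    u (t + s) = G s (u t) + ∫ r in (0 : ℝ)..s, G (s - r) (g (t + r)) := by
  rw [hu (t + s) ⟨by positivity, hts⟩, hu t ⟨ht, by linarith⟩, map_add, ← hG.apply_add,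
    add_comm s t, add_assoc,
    ← intervalIntegral.integral_add_adjacent_intervals (hG.intervalIntegrable hg _ 0 t)
      (hG.intervalIntegrable hg _ t (t + s)),
    ← (G s).intervalIntegral_comp_comm (hG.intervalIntegrable hg t 0 t)]
  congr 2
  · congr 1
    ext r
    rw [← hG.apply_add]
    congr 2
    ring
  · have h := intervalIntegral.integral_comp_add_left (a := 0) (b := s)
      (fun r => G (t + s - r) (g r)) t
    rw [add_zero] at h
    rw [← h]
    congr 1
    ext r
    congr 2
    ring

/-- If `P` commutes with the group and `t ↦ G(t) P` has the derivative `G(t) B`, then the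
component `P u` of a mild solution satisfies the equation in the classical sense. -/
theorem mild_solution_hasDerivAt {P B : E →L[ℝ] E} (hPG : ∀ t x, P (G t x) = G t (P x))
    (hB : ∀ t, HasDerivAt (fun t => (G t).comp P) ((G t).comp B) t) {t : ℝ} (ht : t ∈ Ioo 0 S) :
    HasDerivAt (fun t => P (u t)) (B (u t) + P (g t)) t := by
  -- `B` is the derivative of `G(t) P` at `t = 0`, so it commutes with the group as `P` does
  have hBG : ∀ s x, B (G s x) = G s (B x) := by
    intro s x
    have h0 := hB 0
    rw [hG.map_zero, ContinuousLinearMap.id_comp] at h0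
    have h1 := h0.clm_apply (hasDerivAt_const (0 : ℝ) (G s x))
    have h2 := ((G s).hasFDerivAt.comp_hasDerivAt (0 : ℝ)
      (h0.clm_apply (hasDerivAt_const (0 : ℝ) x)))
    simp only [map_zero, add_zero] at h1 h2
    refine h1.unique (h2.congr_of_eventuallyEq (Eventually.of_forall fun r => ?_))
    simp only [ContinuousLinearMap.comp_apply, Function.comp_apply, hPG, ← hG.apply_add]
    rw [add_comm]
  -- variation of constants: `u(t) = G(t) y(t)`
  let y : ℝ → E := fun t => u 0 + ∫ s in (0 : ℝ)..t, G (0 - s) (g s)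
  have hcont : Continuous fun s => G (0 - s) (g s) := hG.continuous_apply (by fun_prop) hg
  have hy : HasDerivAt y (G (0 - t) (g t)) t :=
    (hcont.integral_hasStrictDerivAt 0 t).hasDerivAt.const_add _
  have huy : ∀ t ∈ Icc 0 S, u t = G t (y t) := by
    intro t ht
    rw [hu t ht, map_add, ← (G t).intervalIntegral_comp_comm (hG.intervalIntegrable hg 0 0 t)]
    congr 2
    ext s
    rw [← hG.apply_add]
    congr 2
    ring
  have h := (hB t).clm_apply hy
  have e1 : (G t) (B (y t)) + G t (P (G (0 - t) (g t))) = B (u t) + P (g t) := by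
    rw [← hBG, ← hPG, ← hG.apply_add, huy t ⟨ht.1.le, ht.2.le⟩]
    simp [hG.map_zero]
  simp only [ContinuousLinearMap.comp_apply] at h
  rw [e1] at h
  refine h.congr_of_eventuallyEq ?_
  filter_upwards [Icc_mem_nhds ht.1 ht.2] with r hr
  rw [huy r hr, hPG]

end MildSolutions

/-! ### Analyticity of observed mild solutions in a Hilbert space -/

section ObservedSolutions

open Filter Topology MeasureTheory Complexified

/-- The restriction of `φ` to the window `[t, t + T]`, as a path on `[0,T]`. -/
def window {E : Type*} [TopologicalSpace E] {φ : ℝ → E} (hφ : Continuous φ) (T t : ℝ) :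
    C(Icc 0 T, E) :=
  ⟨fun s => φ (t + s), by fun_prop⟩

@[simp] theorem window_apply {E : Type*} [TopologicalSpace E] {φ : ℝ → E} (hφ : Continuous φ)
    {T : ℝ} (t : ℝ) (s : Icc 0 T) : window hφ T t s = φ (t + s) := rfl

theorem continuous_window {E : Type*} [TopologicalSpace E] {φ : ℝ → E} (hφ : Continuous φ)
    (T t₀ : ℝ) :
    Continuous fun t => window hφ T (t₀ + t) :=
  ContinuousMap.continuous_of_continuous_uncurry _ (by
    show Continuous fun p : ℝ × Icc 0 T => φ (t₀ + p.1 + p.2)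
    fun_prop)

variable {E : Type*} [NormedAddCommGroup E] [InnerProductSpace ℝ E]

/-- The windows of a function with a holomorphic extension are the values at real times of a
holomorphic function with values in the space of paths. -/
theorem exists_contDiffAt_window {h : ℝ → E} (hh : Continuous h) {H : ℂ → Complexified E}
    {S T μ t₀ : ℝ} (hμ : 0 < μ) (hHh : ∀ t ∈ Icc 0 S, H t = ofReal (h t))
    (hH : DifferentiableOn ℂ H (Ioo 0 S ×ℂ Ioo (-μ) μ)) (ht₀ : 0 < t₀) (ht₀S : t₀ + T < S)
    [CompleteSpace E] :
    ∃ k : ℂ → C(Icc 0 T, Complexified E), ContDiffAt ℂ 1 k 0 ∧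
      ∀ᶠ t : ℝ in 𝓝 0, k t = ofRealPath (window hh T (t₀ + t)) := by
  let ι : C(Icc 0 T, ℂ) := ⟨fun s => ((s : ℝ) : ℂ), by fun_prop⟩
  let a : ℂ → C(Icc 0 T, ℂ) := fun z => ContinuousMap.const _ (t₀ + z) + ι
  have ha : ∀ z s, a z s = t₀ + z + ((s : ℝ) : ℂ) := fun z s => rfl
  have had : ContDiff ℂ 1 a := by
    have : a = fun z => z • (1 : C(Icc 0 T, ℂ)) + (ContinuousMap.const _ (t₀ : ℂ) + ι) := by
      ext z s
      simp only [a, ContinuousMap.add_apply, ContinuousMap.smul_apply, ContinuousMap.one_apply,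
        ContinuousMap.const_apply, smul_eq_mul, mul_one]
      ring
    rw [this]
    fun_prop
  have hopen : IsOpen (Ioo 0 S ×ℂ Ioo (-μ) μ) := isOpen_Ioo.reProdIm isOpen_Ioo
  have hmem : ∀ s, a 0 s ∈ Ioo 0 S ×ℂ Ioo (-μ) μ := by
    intro s
    rw [ha, Complex.mem_reProdIm]
    have h1 := s.2.1
    have h2 := s.2.2
    simp only [add_zero, Complex.add_re, Complex.ofReal_re, Complex.add_im, Complex.ofReal_im]
    exact ⟨⟨by linarith, by linarith⟩, by linarith, hμ⟩
  have hHc : ContDiffOn ℂ 1 H (Ioo 0 S ×ℂ Ioo (-μ) μ) := hH.contDiffOn hopen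
  refine ⟨fun z => superpose H (a z), (contDiffAt_superpose hopen hHc hmem).comp _
    had.contDiffAt, ?_⟩
  have hev : ∀ᶠ t : ℝ in 𝓝 0, ∀ s, a t s ∈ Ioo 0 S ×ℂ Ioo (-μ) μ := by
    have hc : Continuous fun t : ℝ => a t := had.continuous.comp Complex.continuous_ofReal
    exact hc.continuousAt.eventually_mem ((isOpen_forall_mem hopen).mem_nhds (by simpa using hmem))
  filter_upwards [hev] with t ht
  ext1 s
  rw [superpose_apply hHc.continuousOn ht, ofRealPath_apply, window_apply]
  have h1 := (ht s).1
  rw [ha] at h1 ⊢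
  have h2 : (t₀ : ℂ) + t + ((s : ℝ) : ℂ) = ((t₀ + t + s : ℝ) : ℂ) := by push_cast; rfl
  rw [h2] at h1 ⊢
  exact hHh _ ⟨h1.1.le, h1.2.le⟩

/-- Analyticity of an observed mild solution on a window of length `T` on which the linearized
high-frequency equation is observable. -/
theorem analyticAt_of_observable_window [CompleteSpace E] {G : ℝ → E →L[ℝ] E}
    (hG : IsIsometryGroup G) {T S R₀ μ : ℝ} (hT : 0 ≤ T) {P B C : E →L[ℝ] E}
    (hP : ∀ x, P (P x) = P x) (hPG : ∀ t x, P (G t x) = G t (P x))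
    (hB : ∀ t, HasDerivAt (fun t => (G t).comp P) ((G t).comp B) t)
    {f : E → E} (hf : NonlinearityAssumption f R₀) {h₁ h₂ u : ℝ → E} (hh₁ : Continuous h₁)
    (hh₂ : Continuous h₂) (huc : Continuous u) (hR : ∀ t, ‖u t + h₁ t‖ < 4 * R₀)
    {H₁ H₂ : ℂ → Complexified E} (hμ : 0 < μ)
    (hHh₁ : ∀ t ∈ Icc 0 S, H₁ t = ofReal (h₁ t)) (hHh₂ : ∀ t ∈ Icc 0 S, H₂ t = ofReal (h₂ t))
    (hH₁ : DifferentiableOn ℂ H₁ (Ioo 0 S ×ℂ Ioo (-μ) μ))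
    (hH₂ : DifferentiableOn ℂ H₂ (Ioo 0 S ×ℂ Ioo (-μ) μ))
    (hu : ∀ t ∈ Icc 0 S, u t = G t (u 0)
      + ∫ s in (0 : ℝ)..t, G (t - s) (f (u s + h₁ s) + h₂ s))
    (hCu : ∀ t ∈ Icc 0 S, C (u t) = 0)
    {t₀ : ℝ} (ht₀ : 0 < t₀) (ht₀S : t₀ + T < S) {c : ℝ} (hc : 0 < c)
    (hobs : ∀ w : C(Icc 0 T, E), (∀ t, (1 - P) (w t) = w t) →
      (∀ t : Icc 0 T, w t = G t (w ⟨0, left_mem_Icc.2 hT⟩) + ∫ s in (0 : ℝ)..t,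
        G (t - s) ((1 - P) (fderiv ℝ f (window (huc.add hh₁) T t₀ (projIcc 0 T hT s))
          (w (projIcc 0 T hT s))))) →
      ‖w ⟨0, left_mem_Icc.2 hT⟩‖ ^ 2
        ≤ c ^ 2 * ∫ t in (0 : ℝ)..T, ‖C (w (projIcc 0 T hT t))‖ ^ 2)
    {s₀ : ℝ} (hs₀ : s₀ ∈ Icc 0 T) : AnalyticAt ℝ u (t₀ + s₀) := by
  obtain ⟨δ, hδ, L, -, F, hFf, -, hFd, -, -, hFlip⟩ := hf.holomorphic
  set Ω := interior (cylinder E (4 * R₀) (2 * δ))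
  have hΩ : IsOpen Ω := isOpen_interior
  have hFc : ContDiffOn ℂ 1 F Ω := by
    intro z hz
    refine ContDiffAt.contDiffWithinAt (contDiffAt_one_iff.2 ⟨fderiv ℂ F, Ω, hΩ.mem_nhds hz, ?_,
      fun x hx => (hFd.differentiableAt (hΩ.mem_nhds hx)).hasFDerivAt⟩)
    refine LipschitzOnWith.continuousOn (K := L.toNNReal) (LipschitzOnWith.of_dist_le_mul ?_)
    intro x hx y hy
    rw [dist_eq_norm, dist_eq_norm]
    exact (hFlip x hx y hy).trans
      (mul_le_mul_of_nonneg_right (Real.le_coe_toNNReal L) (norm_nonneg _))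
  have hΩmem : ∀ x : E, ‖x‖ < 4 * R₀ → ofReal x ∈ Ω := fun x hx =>
    ofReal_mem_interior_cylinder (by positivity) hx
  have hfdiff : Differentiable ℝ f := hf.contDiff.differentiable (by norm_num)
  have hfcont : Continuous (fderiv ℝ f) := hf.contDiff.continuous_fderiv (by norm_num)
  set Q : E →L[ℝ] E := 1 - P with hQ
  have hQapply : ∀ x, Q x = x - P x := fun x => rfl
  have hQQ : ∀ x, Q (Q x) = Q x := fun x => by simp [hQapply, hP]
  have hQG : ∀ t x, Q (G t x) = G t (Q x) := fun t x => by simp [hQapply, hPG]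
  -- the potential, the source term and the velocity of the low frequencies
  have hp : Continuous fun t => u t + h₁ t := huc.add hh₁
  have hfp : Continuous fun t => f (u t + h₁ t) := hfdiff.continuous.comp hp
  have hg : Continuous fun t => f (u t + h₁ t) + h₂ t := hfp.add hh₂
  have hk : Continuous fun t => B (u t) + P (f (u t + h₁ t) + h₂ t) :=
    (B.continuous.comp huc).add (P.continuous.comp hg)
  let pot := window hp T t₀
  let M' : C(Icc 0 T, E →L[ℝ] E) := ⟨fun s => fderiv ℝ f (pot s), hfcont.comp pot.continuous⟩
  let M : C(Icc 0 T, E →L[ℝ] E) := pathMap (ContinuousLinearMap.compL ℝ E E E Q) M'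
  have hM : ∀ s x, M s x = Q (M' s x) := fun s x => rfl
  obtain ⟨Θ₁, Θ₂, hΘ⟩ := exists_reconstruction hG hT Q C hQG M
    (fun t x => by rw [hM, hQQ]) hc hobs
  let Pu : ℝ → C(Icc 0 T, E) := fun t => pathMap P (window huc T (t₀ + t))
  let Qu : ℝ → C(Icc 0 T, E) := fun t => pathMap Q (window huc T (t₀ + t))
  have hPQ : ∀ t, Pu t + Qu t = window huc T (t₀ + t) := fun t => by
    ext s; simp [Pu, Qu, hQapply]
  have hcw := continuous_window huc T t₀
  -- times close to `0` keep the window inside `[0, S]`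
  have hnear : ∀ᶠ t : ℝ in 𝓝 0, 0 < t₀ + t ∧ t₀ + t + T < S := by
    have h1 : Continuous fun t : ℝ => t₀ + t := by fun_prop
    have h2 : Continuous fun t : ℝ => t₀ + t + T := by fun_prop
    exact (h1.continuousAt.eventually (lt_mem_nhds (by simpa using ht₀))).and
      (h2.continuousAt.eventually (gt_mem_nhds (by simpa using ht₀S)))
  -- the high frequencies are reconstructed from the low frequencies
  have hQu : ∀ᶠ t : ℝ in 𝓝 0, Qu t = -Θ₁ (pathMap C (Pu t))
      + Θ₂ (pathMap Q (window hg T (t₀ + t)) - mulOp M (Qu t)) := by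
    filter_upwards [hnear] with t ht
    have h0S : ∀ s : Icc 0 T, t₀ + t + s ∈ Icc 0 S := fun s =>
      ⟨by linarith [s.2.1], by linarith [s.2.2]⟩
    have h1 : pathMap C (Qu t) = -pathMap C (Pu t) := by
      rw [eq_neg_iff_add_eq_zero, ← map_add, add_comm, hPQ]
      ext s
      exact hCu _ (h0S s)
    rw [← map_neg, ← h1]
    refine hΘ (Qu t) _ (fun s => hQQ _) fun s => ?_
    rw [add_sub_cancel, duhamel_apply]
    show Q (u (t₀ + t + s)) = G s (Q (u (t₀ + t + 0))) + _
    have hi : IntervalIntegrable (fun r => G (s - r) (f (u (t₀ + t + r) + h₁ (t₀ + t + r))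
        + h₂ (t₀ + t + r))) volume 0 s :=
      hG.intervalIntegrable (hg.comp (continuous_const_add (t₀ + t))) _ _ _
    rw [mild_solution_translate hG hg hu ht.1.le s.2.1 (h0S s).2, map_add, hQG, add_zero,
      ← Q.intervalIntegral_comp_comm hi]
    congr 1
    refine intervalIntegral.integral_congr fun r hr => ?_
    rw [uIcc_of_le s.2.1] at hr
    simp only [hQG, pathMap_apply, window_apply,
      projIcc_of_mem hT ⟨hr.1, hr.2.trans s.2.2⟩]
  -- the differential equation of the low frequencies
  have hPu : ∀ᶠ t : ℝ in 𝓝 0, Pu t = Pu 0 + ∫ r in (0 : ℝ)..t, window hk T (t₀ + r) := by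
    obtain ⟨ρ, hρ, hball⟩ := Metric.eventually_nhds_iff_ball.1 hnear
    filter_upwards [Metric.ball_mem_nhds _ hρ] with t ht
    have hint : IntervalIntegrable (fun r => window hk T (t₀ + r)) volume 0 t :=
      (continuous_window hk T t₀).intervalIntegrable _ _
    ext s
    have h1 := (ContinuousMap.evalCLM ℝ s : C(Icc 0 T, E) →L[ℝ] E).intervalIntegral_comp_comm hint
    have h2 : (∫ r in (0 : ℝ)..t, B (u (t₀ + r + s)) + P (f (u (t₀ + r + s) + h₁ (t₀ + r + s))
        + h₂ (t₀ + r + s))) = P (u (t₀ + t + s)) - P (u (t₀ + 0 + s)) := by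
      refine intervalIntegral.integral_eq_sub_of_hasDerivAt
        (f := fun r => P (u (t₀ + r + s))) (fun r hr => ?_) ?_
      · have hr' : r ∈ Metric.ball (0 : ℝ) ρ :=
          (convex_ball (0 : ℝ) ρ).ordConnected.uIcc_subset (Metric.mem_ball_self hρ) ht hr
        have h3 := hball r hr'
        have h4 := mild_solution_hasDerivAt hG hg hu hPG hB (t := t₀ + r + s)
          ⟨by linarith [s.2.1], by linarith [s.2.2]⟩
        have h5 : HasDerivAt (fun r => t₀ + r + (s : ℝ)) 1 r :=
          ((hasDerivAt_id r).const_add t₀).add_const _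
        simpa [Function.comp_def] using h4.scomp r h5
      · exact (hk.comp (by fun_prop : Continuous fun r => t₀ + r + (s : ℝ))).intervalIntegrable _ _
    show P (u (t₀ + t + s)) = P (u (t₀ + 0 + s)) + (∫ r in (0 : ℝ)..t, window hk T (t₀ + r)) s
    rw [← sub_eq_iff_eq_add', ← h2]
    exact h1
  -- the sources, the nonlinearity and its derivative on complex paths agree with the real ones on
  -- real paths
  obtain ⟨k₁, hk₁, hk₁h⟩ := exists_contDiffAt_window (T := T) hh₁ hμ hHh₁ hH₁ ht₀ ht₀S
  obtain ⟨k₂, hk₂, hk₂h⟩ := exists_contDiffAt_window (T := T) hh₂ hμ hHh₂ hH₂ ht₀ ht₀S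
  have hsum : ∀ᶠ t : ℝ in 𝓝 0,
      ofRealPath (Pu t) + ofRealPath (Qu t) + k₁ t = ofRealPath (window hp T (t₀ + t)) := by
    filter_upwards [hk₁h] with t ht
    rw [ht, ← map_add, hPQ, ← map_add]
    rfl
  have hbase : ofRealPath (Pu 0) + ofRealPath (Qu 0) + k₁ 0 = ofRealPath pot := by
    simpa [pot] using hsum.self_of_nhds
  have hmemΩ : ∀ t s, ofRealPath (window hp T t) s ∈ Ω := fun t s => hΩmem _ (hR _)
  have hNf : ∀ t, superpose F (ofRealPath (window hp T t)) = ofRealPath (window hfp T t) := by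
    intro t
    ext1 s
    rw [superpose_apply hFc.continuousOn (hmemΩ t)]
    exact hFf _ (mem_closedBall_zero_iff.2 (hR _).le)
  have hN' : ∀ w : C(Icc 0 T, E), mulOp (superpose (fderiv ℂ F) (ofRealPath pot)) (ofRealPath w)
      = ofRealPath (mulOp M' w) := by
    intro w
    ext1 s
    rw [mulOp_apply, superpose_apply (hFc.continuousOn_fderiv_of_isOpen hΩ le_rfl) (hmemΩ t₀)]
    refine fderiv_ofReal_apply ?_ (hfdiff _)
      (hFd.differentiableAt (hΩ.mem_nhds (hmemΩ t₀ s))) (w s)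
    filter_upwards [Metric.isOpen_ball.mem_nhds (mem_ball_zero_iff.2 (hR (t₀ + s)))] with y hy
    exact hFf y (Metric.ball_subset_closedBall hy)
  obtain ⟨γ, hγ, hγu⟩ : ∃ g : ℂ → C(Icc 0 T, Complexified E), ContDiffAt ℂ 1 g 0 ∧
      ∀ᶠ t : ℝ in 𝓝 0, g t = ofRealPath (Pu t) + ofRealPath (Qu t) := by
    have hVc : Continuous fun t => ofRealPath (Pu t) :=
      ofRealPath.continuous.comp ((pathMap P).continuous.comp hcw)
    have hWc : Continuous fun t => ofRealPath (Qu t) :=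
      ofRealPath.continuous.comp ((pathMap Q).continuous.comp hcw)
    have hN1 : ContDiffAt ℂ 1 (superpose F) (ofRealPath (Pu 0) + ofRealPath (Qu 0) + k₁ 0) := by
      rw [hbase]; exact contDiffAt_superpose hΩ hFc (hmemΩ t₀)
    have hN2 : HasFDerivAt (superpose F) (mulOp (superpose (fderiv ℂ F) (ofRealPath pot)))
        (ofRealPath (Pu 0) + ofRealPath (Qu 0) + k₁ 0) := by
      rw [hbase]; exact hasFDerivAt_superpose hΩ hFc (hmemΩ t₀)
    refine exists_contDiffAt_of_coupled_system (Z := C(Icc 0 T, Complexified E))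
      (N := superpose F) (N' := mulOp (superpose (fderiv ℂ F) (ofRealPath pot)))
      (K := complexifyPath (Θ₁.comp (pathMap C))) (L := complexifyPath (Θ₂.comp (pathMap Q)))
      (B := complexifyPath (pathMap B)) (P := complexifyPath (pathMap P)) (h₁ := k₁) (h₂ := k₂)
      (V := fun t => ofRealPath (Pu t)) (W := fun t => ofRealPath (Qu t))
      (v := fun t => ofRealPath (window hk T (t₀ + t)))
      hVc hWc hN1 hN2 hk₁ hk₂ ?_ ?_ ?_
    · filter_upwards [hQu, hsum, hk₂h] with t h1 h2 h3
      rw [h2, hNf, h3, hN', ← map_add, ← map_sub, complexifyPath_ofRealPath,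
        complexifyPath_ofRealPath, ← map_neg, ← map_add]
      congr 1
      conv_lhs => rw [h1]
      simp only [ContinuousLinearMap.comp_apply]
      congr 2
      ext s
      simp [hM, map_sub]
    · filter_upwards [hPu] with t ht
      rw [ofRealPath.intervalIntegral_comp_comm ((continuous_window hk T t₀).intervalIntegrable _ _),
        ht, map_add]
    · filter_upwards [hsum, hk₂h] with r h2 h3
      rw [h2, hNf, h3, ← map_add, ← map_add, hPQ, complexifyPath_ofRealPath,
        complexifyPath_ofRealPath, ← map_add]
      rfl
  let p : C(Icc 0 T, Complexified E) →L[ℝ] E :=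
    reL.comp ((ContinuousMap.evalCLM ℂ (⟨s₀, hs₀⟩ : Icc 0 T)).restrictScalars ℝ)
  have h1 : AnalyticAt ℝ (fun t => u (t₀ + t + s₀)) 0 := by
    refine analyticAt_of_contDiffAt_complex hγ p ?_
    filter_upwards [hγu] with t ht
    rw [ht, ← map_add, hPQ]
    rfl
  have h2 : AnalyticAt ℝ (fun r : ℝ => r - (t₀ + s₀)) (t₀ + s₀) := by fun_prop
  have h3 := AnalyticAt.fun_comp (f := fun r : ℝ => r - (t₀ + s₀))
    (g := fun t => u (t₀ + t + s₀)) (by simpa using h1) h2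
  refine h3.congr (Eventually.of_forall fun r => ?_)
  show u (t₀ + (r - (t₀ + s₀)) + s₀) = u r
  congr 1
  ring

end ObservedSolutions

/-! ### Skew-adjoint operators and their groups -/

section SkewAdjoint

open Filter Topology MeasureTheory

variable {X : Type*} [NormedAddCommGroup X] [InnerProductSpace ℝ X]

/-- `x` belongs to the domain of `A`, and `A x = y`. -/
def MapsAt (A : X →ₗ.[ℝ] X) (x y : X) : Prop := ∃ h : x ∈ A.domain, A ⟨x, h⟩ = y

theorem MapsAt.add {A : X →ₗ.[ℝ] X} {x x' y y' : X} (h : MapsAt A x y) (h' : MapsAt A x' y') :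
    MapsAt A (x + x') (y + y') := by
  obtain ⟨hx, rfl⟩ := h
  obtain ⟨hx', rfl⟩ := h'
  exact ⟨A.domain.add_mem hx hx', A.map_add ⟨x, hx⟩ ⟨x', hx'⟩⟩

theorem MapsAt.smul {A : X →ₗ.[ℝ] X} {x y : X} (h : MapsAt A x y) (c : ℝ) :
    MapsAt A (c • x) (c • y) := by
  obtain ⟨hx, rfl⟩ := h
  exact ⟨A.domain.smul_mem c hx, A.map_smul c ⟨x, hx⟩⟩

theorem IsGroupGeneratedBy.apply_add {A : X →ₗ.[ℝ] X} {U : ℝ → X →L[ℝ] X}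
    (hU : IsGroupGeneratedBy A U) (s t : ℝ) (x : X) : U (s + t) x = U s (U t x) := by
  rw [hU.map_add]; rfl

theorem IsGroupGeneratedBy.apply_zero {A : X →ₗ.[ℝ] X} {U : ℝ → X →L[ℝ] X}
    (hU : IsGroupGeneratedBy A U) (x : X) : U 0 x = x := by
  rw [hU.map_zero]; rfl

variable [CompleteSpace X] {A : X →ₗ.[ℝ] X}

theorem IsSkewAdjointOp.inner_eq (hA : IsSkewAdjointOp A) {x x' y y' : X} (hx : MapsAt A x x')
    (hy : MapsAt A y y') : inner ℝ x' y = -inner ℝ x y' := by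
  obtain ⟨hxd, rfl⟩ := hx
  obtain ⟨hyd, rfl⟩ := hy
  have h := LinearPMap.adjoint_isFormalAdjoint hA.dense_domain
  rw [hA.adjoint_eq] at h
  have h1 := h ⟨x, hxd⟩ ⟨y, hyd⟩
  rw [LinearPMap.neg_apply, inner_neg_left] at h1
  exact neg_eq_iff_eq_neg.1 h1

/-- A skew-adjoint operator is maximal: it contains every pair that is skew to its graph. -/
theorem IsSkewAdjointOp.mapsAt_of_forall_inner (hA : IsSkewAdjointOp A) {x x' : X}
    (h : ∀ z z', MapsAt A z z' → inner ℝ x' z = -inner ℝ x z') : MapsAt A x x' := by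
  have h1 : ∀ z : A.domain, inner ℝ (-x') (z : X) = inner ℝ x (A z) := fun z => by
    rw [inner_neg_left, h z (A z) ⟨z.2, rfl⟩, neg_neg]
  have hd : x ∈ A.adjoint.domain := LinearPMap.mem_adjoint_domain_of_exists x ⟨-x', h1⟩
  have h2 := LinearPMap.adjoint_apply_eq hA.dense_domain ⟨x, hd⟩ h1
  have h3 : MapsAt A.adjoint x (-x') := ⟨hd, h2⟩
  rw [hA.adjoint_eq] at h3
  obtain ⟨hd', h4⟩ := h3
  exact ⟨hd', neg_injective h4⟩

theorem IsSkewAdjointOp.dense_setOf_mapsAt (hA : IsSkewAdjointOp A) :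
    Dense {x | ∃ y, MapsAt A x y} :=
  hA.dense_domain.mono fun x hx => ⟨A ⟨x, hx⟩, hx, rfl⟩

/-- Eigenvectors of `A²` with distinct eigenvalues are orthogonal. -/
theorem IsSkewAdjointOp.inner_eq_zero (hA : IsSkewAdjointOp A) {x x' y y' : X} {l m : ℝ}
    (hx : MapsAt A x x') (hx' : MapsAt A x' (-l • x)) (hy : MapsAt A y y')
    (hy' : MapsAt A y' (-m • y)) (hlm : l ≠ m) : inner ℝ x y = 0 := by
  have h1 := hA.inner_eq hx' hy
  have h2 := hA.inner_eq hx hy'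
  rw [h2, real_inner_smul_left, real_inner_smul_right, neg_neg] at h1
  have h3 : (l - m) * inner ℝ x y = 0 := by linarith
  exact (mul_eq_zero.1 h3).resolve_left (sub_ne_zero.2 hlm)

/-- For a skew-adjoint `A` the equation `A* A e_j = λ_j e_j` means `A (A e_j) = -λ_j e_j`. -/
theorem IsEigenbasis.exists_mapsAt {e : HilbertBasis ℕ ℝ X} {lam : ℕ → ℝ}
    (he : IsEigenbasis (adjointMulSelf A) e lam) (hA : IsSkewAdjointOp A) :
    ∃ a : ℕ → X, ∀ j, MapsAt A (e j) (a j) ∧ MapsAt A (a j) (-lam j • e j) := by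
  have key : ∀ j, ∃ y, MapsAt A (e j) y ∧ MapsAt A y (-lam j • e j) := by
    intro j
    obtain ⟨h, hj⟩ := he.eigen j
    obtain ⟨⟨x, hx⟩, hx2, rfl⟩ := h.1
    refine ⟨A ⟨e j, hx⟩, ⟨hx, rfl⟩, ?_⟩
    have h3 : MapsAt A.adjoint (A ⟨e j, hx⟩) (lam j • e j) := ⟨hx2, hj⟩
    rw [hA.adjoint_eq] at h3
    obtain ⟨hd, h4⟩ := h3
    exact ⟨hd, by rw [neg_smul, ← h4, LinearPMap.neg_apply, neg_neg]⟩
  choose a ha using key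
  exact ⟨a, ha⟩

namespace IsGroupGeneratedBy

variable {U : ℝ → X →L[ℝ] X} (hU : IsGroupGeneratedBy A U)
include hU

omit [CompleteSpace X] in
theorem hasDerivAt {x y : X} (h : MapsAt A x y) (t : ℝ) :
    HasDerivAt (fun t => U t x) (U t y) t := by
  have h0 : HasDerivAt (fun s => U s x) y (t - t) := by
    rw [sub_self]
    exact (hU.generator x y).2 h
  have h1 := (U t).hasFDerivAt.comp_hasDerivAt t (h0.comp_sub_const t t)
  refine h1.congr_of_eventuallyEq (Eventually.of_forall fun s => ?_)
  show U s x = U t (U (s - t) x)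
  rw [← hU.apply_add, add_sub_cancel]

omit [CompleteSpace X] in
theorem mapsAt_apply {x y : X} (h : MapsAt A x y) (t : ℝ) : MapsAt A (U t x) (U t y) := by
  refine (hU.generator _ _).1 ?_
  have h1 : HasDerivAt (fun s => U s x) (U t y) (0 + t) := by
    rw [zero_add]
    exact hU.hasDerivAt h t
  refine (h1.comp_add_const 0 t).congr_of_eventuallyEq (Eventually.of_forall fun s => ?_)
  exact (hU.apply_add s t x).symm

theorem norm_map (hA : IsSkewAdjointOp A) (t : ℝ) (x : X) : ‖U t x‖ = ‖x‖ := by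
  have hcl : IsClosed {x | ‖U t x‖ = ‖x‖} := isClosed_eq (by fun_prop) (by fun_prop)
  refine hcl.closure_subset_iff.2 ?_ (hA.dense_setOf_mapsAt x)
  rintro x ⟨y, h⟩
  have hd : ∀ s, HasDerivAt (fun s => ‖U s x‖ ^ 2) 0 s := by
    intro s
    have h1 := (hU.hasDerivAt h s).norm_sq
    have h2 := hA.inner_eq (hU.mapsAt_apply h s) (hU.mapsAt_apply h s)
    rw [real_inner_comm] at h2
    have h3 : inner ℝ (U s x) (U s y) = 0 := by linarith
    rwa [h3, mul_zero] at h1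
  have h4 := is_const_of_deriv_eq_zero (fun s => (hd s).differentiableAt)
    (fun s => (hd s).deriv) t 0
  rw [hU.apply_zero] at h4
  exact (sq_eq_sq₀ (norm_nonneg _) (norm_nonneg _)).1 h4

theorem inner_apply (hA : IsSkewAdjointOp A) (t : ℝ) (x y : X) :
    inner ℝ x (U t y) = inner ℝ (U (-t) x) y := by
  let V : X →ₗᵢ[ℝ] X := ⟨(U t : X →ₗ[ℝ] X), hU.norm_map hA t⟩
  have h := V.inner_map_map (U (-t) x) y
  have h2 : V (U (-t) x) = x := by
    show U t (U (-t) x) = x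
    rw [← hU.apply_add, add_neg_cancel, hU.apply_zero]
  rw [h2] at h
  exact h

end IsGroupGeneratedBy

end SkewAdjoint

/-! ### Existence of the group of a diagonalizable skew-adjoint operator -/

section GroupExistence

open Filter Topology MeasureTheory

variable {X : Type*} [NormedAddCommGroup X] [InnerProductSpace ℝ X]

/-- The vector `cos(√l t) x + l^{-1/2} sin(√l t) y`, which is `e^{tA} x` if `A x = y` and
`A y = -l x`. For `l = 0` the second coefficient is `0` instead of `t`, which does no harm since
then `y = 0`. -/
def planeRotation (l : ℝ) (x y : X) (t : ℝ) : X :=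
  Real.cos (√l * t) • x + (Real.sin (√l * t) / √l) • y

theorem hasDerivAt_planeRotation {l : ℝ} (hl : 0 ≤ l) {x y : X} (h0 : l = 0 → y = 0) (t : ℝ) :
    HasDerivAt (planeRotation l x y) (planeRotation l y (-l • x) t) t := by
  have h1 : HasDerivAt (fun t => √l * t) √l t := by
    simpa using (hasDerivAt_id t).const_mul √l
  have h2 := (h1.cos.smul_const x).add ((h1.sin.div_const √l).smul_const y)
  refine h2.congr_deriv ?_
  rcases hl.eq_or_lt with rfl | hl
  · simp [planeRotation, h0 rfl]
  · have h3 : √l ≠ 0 := (Real.sqrt_pos.2 hl).ne'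
    have h4 : l = √l * √l := (Real.mul_self_sqrt hl.le).symm
    rw [planeRotation, mul_div_cancel_right₀ _ h3, add_comm, smul_smul]
    congr 2
    conv_rhs => rw [h4]
    rw [Real.sqrt_mul_self (Real.sqrt_nonneg l)]
    field_simp

theorem MapsAt.planeRotation {A : X →ₗ.[ℝ] X} {l : ℝ} {x y : X} (h : MapsAt A x y)
    (h' : MapsAt A y (-l • x)) (t : ℝ) :
    MapsAt A (planeRotation l x y t) (planeRotation l y (-l • x) t) :=
  (h.smul _).add (h'.smul _)

theorem planeRotation_add {l : ℝ} (hl : 0 ≤ l) (x y : X) (s t : ℝ) :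
    planeRotation l x y (s + t) = Real.cos (√l * t) • planeRotation l x y s
      + (Real.sin (√l * t) / √l) • planeRotation l y (-l • x) s := by
  have h : Real.sin (√l * t) / √l * (Real.sin (√l * s) / √l * l)
      = Real.sin (√l * t) * Real.sin (√l * s) := by
    rcases hl.eq_or_lt with rfl | hl
    · simp
    · have h3 : √l ≠ 0 := (Real.sqrt_pos.2 hl).ne'
      have h4 : l = √l * √l := (Real.mul_self_sqrt hl.le).symm
      field_simp
      rw [Real.sq_sqrt hl.le]
      ring
  simp only [planeRotation, mul_add, Real.cos_add, Real.sin_add, smul_add, smul_smul, mul_neg]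
  rw [h]
  module

theorem HilbertBasis.ext_inner {e : HilbertBasis ℕ ℝ X} {x y : X}
    (h : ∀ j, inner ℝ (e j) x = inner ℝ (e j) y) : x = y := by
  apply e.repr.injective
  ext j
  rw [e.repr_apply_apply, e.repr_apply_apply, h]

theorem HilbertBasis.clm_ext {Y : Type*} [NormedAddCommGroup Y] [NormedSpace ℝ Y]
    {e : HilbertBasis ℕ ℝ X} {L M : X →L[ℝ] Y} (h : ∀ j, L (e j) = M (e j)) : L = M := by
  refine ContinuousLinearMap.ext_on (s := range e) ?_ (by rintro _ ⟨j, rfl⟩; exact h j)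
  rw [Submodule.dense_iff_topologicalClosure_eq_top]
  exact e.dense_span

variable [CompleteSpace X] {A : X →ₗ.[ℝ] X}

/-- Stone's theorem for a skew-adjoint operator `A` such that `A* A` has an orthonormal
eigenbasis: on the plane spanned by `e_j` and `A e_j` the group acts by rotations. -/
theorem exists_isGroupGeneratedBy (hA : IsSkewAdjointOp A) {e : HilbertBasis ℕ ℝ X}
    {lam : ℕ → ℝ} {a : ℕ → X}
    (ha : ∀ j, MapsAt A (e j) (a j) ∧ MapsAt A (a j) (-lam j • e j)) :
    ∃ U : ℝ → X →L[ℝ] X, IsGroupGeneratedBy A U := by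
  have horth : ∀ i k, inner ℝ (e i) (e k) = if i = k then (1 : ℝ) else 0 :=
    orthonormal_iff_ite.mp e.orthonormal
  have hea : ∀ j k, inner ℝ (a j) (e k) = -inner ℝ (e j) (a k) := fun j k =>
    hA.inner_eq (ha j).1 (ha k).1
  have haa : ∀ j k, inner ℝ (a j) (a k) = lam k * if j = k then (1 : ℝ) else 0 := fun j k => by
    rw [hA.inner_eq (ha j).1 (ha k).2, real_inner_smul_right, horth]
    ring
  have hne : ∀ j k, lam j ≠ lam k → inner ℝ (e j) (a k) = 0 := fun j k hjk => by
    refine hA.inner_eq_zero (ha j).1 (ha j).2 (ha k).2 ?_ hjk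
    exact (ha k).1.smul _
  have hlam : ∀ j, lam j = ‖a j‖ ^ 2 := fun j => by
    rw [← real_inner_self_eq_norm_sq, haa]; simp
  have hlam0 : ∀ j, 0 ≤ lam j := fun j => by rw [hlam]; positivity
  have ha0 : ∀ j, lam j = 0 → a j = 0 := fun j hj => by
    rw [hlam] at hj
    exact norm_eq_zero.1 (pow_eq_zero_iff two_ne_zero |>.1 hj)
  have hself : ∀ j, inner ℝ (e j) (a j) = 0 := fun j => by
    have := hea j j
    rw [real_inner_comm] at this
    linarith
  -- the prospective values of `e^{tA} e_j` and `e^{tA} A e_j`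
  let v : ℝ → ℕ → X := fun t j => planeRotation (lam j) (e j) (a j) t
  let d : ℝ → ℕ → X := fun t j => planeRotation (lam j) (a j) (-lam j • e j) t
  have hvd : ∀ t j, HasDerivAt (fun t => v t j) (d t j) t := fun t j =>
    hasDerivAt_planeRotation (hlam0 j) (ha0 j) t
  have hvm : ∀ t j, MapsAt A (v t j) (d t j) := fun t j => (ha j).1.planeRotation (ha j).2 t
  have hv : ∀ t, Orthonormal ℝ (v t) := by
    intro t
    rw [orthonormal_iff_ite]
    intro j k
    simp only [v, planeRotation, inner_add_left, inner_add_right, real_inner_smul_left,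
      real_inner_smul_right, horth, haa, hea]
    by_cases hjk : j = k
    · subst hjk
      rw [hself]
      have h1 : Real.sin (√(lam j) * t) / √(lam j) * (Real.sin (√(lam j) * t) / √(lam j) * lam j)
          = Real.sin (√(lam j) * t) ^ 2 := by
        rcases (hlam0 j).eq_or_lt with h0 | h0
        · simp [← h0]
        · have h3 : √(lam j) ≠ 0 := (Real.sqrt_pos.2 h0).ne'
          field_simp
          rw [Real.sq_sqrt h0.le]
          ring
      have h2 := Real.sin_sq_add_cos_sq (√(lam j) * t)
      simp only [if_true, mul_one, mul_zero, neg_zero, add_zero, zero_add]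
      linarith
    · simp only [hjk, if_false, mul_zero, zero_add, add_zero]
      by_cases hl : lam j = lam k
      · rw [hl]; ring
      · rw [hne j k hl]; ring
  -- `v t` is orthonormal, so an isometry takes `e` to it
  let L : ℝ → X →ₗᵢ[ℝ] X := fun t =>
    (hv t).orthogonalFamily.linearIsometry.comp e.repr.toLinearIsometry
  have hLe : ∀ t j, L t (e j) = v t j := by
    intro t j
    show (hv t).orthogonalFamily.linearIsometry (e.repr (e j)) = v t j
    rw [e.repr_self, OrthogonalFamily.linearIsometry_apply_single]
    simp
  -- the adjoint of `L t` is `L (-t)`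
  have hadj1 : ∀ t x m, inner ℝ (e m) (L t x) = inner ℝ (v (-t) m) x := by
    intro t x m
    have h : (innerSL ℝ (e m)).comp (L t).toContinuousLinearMap = innerSL ℝ (v (-t) m) := by
      refine HilbertBasis.clm_ext (e := e) fun j => ?_
      show inner ℝ (e m) (L t (e j)) = inner ℝ (v (-t) m) (e j)
      rw [hLe]
      simp only [v, planeRotation, inner_add_left, inner_add_right, real_inner_smul_left,
        real_inner_smul_right, horth, hea, mul_neg, Real.cos_neg, Real.sin_neg, neg_div, neg_mul,
        neg_neg]
      by_cases hl : lam m = lam j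
      · rw [hl]
      · have hmj : m ≠ j := fun h => hl (by rw [h])
        rw [hne m j hl]
        simp [hmj]
    exact congrArg (fun M : X →L[ℝ] ℝ => M x) h
  have hadj : ∀ t x y, inner ℝ (L t x) y = inner ℝ x (L (-t) y) := by
    intro t x y
    have h : (innerSL ℝ (L t x)) = (innerSL ℝ x).comp (L (-t)).toContinuousLinearMap := by
      refine HilbertBasis.clm_ext (e := e) fun j => ?_
      show inner ℝ (L t x) (e j) = inner ℝ x (L (-t) (e j))
      rw [real_inner_comm, hadj1, hLe, real_inner_comm]
    exact congrArg (fun M : X →L[ℝ] ℝ => M y) h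
  have hLa : ∀ t j, L t (a j) = d t j := by
    intro t j
    refine HilbertBasis.ext_inner (e := e) fun m => ?_
    rw [hadj1]
    simp only [v, d, planeRotation, inner_add_left, inner_add_right, real_inner_smul_left,
      real_inner_smul_right, horth, haa, mul_neg, Real.cos_neg, Real.sin_neg, neg_div, neg_mul]
    by_cases hl : lam m = lam j
    · rw [hl]
    · have hmj : m ≠ j := fun h => hl (by rw [h])
      rw [hne m j hl]
      simp [hmj]
  have hL0 : ∀ x, L 0 x = x := by
    intro x
    refine HilbertBasis.ext_inner (e := e) fun m => ?_
    rw [hadj1]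
    simp [v, planeRotation]
  have hLadd : ∀ s t, (L (s + t)).toContinuousLinearMap
      = (L s).toContinuousLinearMap.comp (L t).toContinuousLinearMap := by
    intro s t
    refine HilbertBasis.clm_ext (e := e) fun j => ?_
    show L (s + t) (e j) = L s (L t (e j))
    rw [hLe, hLe]
    have h : v t j = Real.cos (√(lam j) * t) • e j + (Real.sin (√(lam j) * t) / √(lam j)) • a j :=
      rfl
    rw [h, map_add, map_smul, map_smul, hLe, hLa]
    exact planeRotation_add (hlam0 j) _ _ _ _
  have hLcont : ∀ x, Continuous fun t => L t x := by
    have hspan : ∀ x ∈ Submodule.span ℝ (range e), Continuous fun t => L t x := by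
      intro x hx
      induction hx using Submodule.span_induction with
      | mem x hx =>
        obtain ⟨j, rfl⟩ := hx
        simp only [hLe]
        exact continuous_iff_continuousAt.2 fun t => (hvd t j).continuousAt
      | zero => simpa using continuous_const
      | add x y _ _ hx hy =>
        simp only [map_add]
        exact hx.add hy
      | smul c x _ hx =>
        simp only [map_smul]
        exact hx.const_smul c
    intro x
    refine continuous_of_uniform_approx_of_continuous fun u hu => ?_
    obtain ⟨ε, hε, hεu⟩ := Metric.mem_uniformity_dist.1 hu
    have hdense : Dense (Submodule.span ℝ (range e) : Set X) := by
      rw [Submodule.dense_iff_topologicalClosure_eq_top]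
      exact e.dense_span
    obtain ⟨y, hy, hxy⟩ := hdense.exists_dist_lt x hε
    exact ⟨fun t => L t y, hspan y hy, fun t => hεu (by rwa [(L t).dist_map])⟩
  -- for `x` in the domain, `L t x = x + ∫₀ᵗ L s (A x) ds`: the `m`-th coordinates of both sides have
  -- the same derivative, as `L (-s) e_m` lies in the domain of the skew-symmetric operator `A`
  have hgen : ∀ {x y : X}, MapsAt A x y → HasDerivAt (fun t => L t x) y 0 := by
    intro x y h
    have hint : ∀ t, L t x = x + ∫ s in (0 : ℝ)..t, L s y := by
      intro t
      refine HilbertBasis.ext_inner (e := e) fun m => ?_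
      have h1 : ∀ s, HasDerivAt (fun s => inner ℝ (e m) (L s x)) (inner ℝ (e m) (L s y)) s := by
        intro s
        have h2 : HasDerivAt (fun s => inner ℝ (v (-s) m) x) (inner ℝ (-d (-s) m) x) s := by
          have h3 := ((hvd (-s) m).scomp s (hasDerivAt_neg s)).inner ℝ (hasDerivAt_const s x)
          simpa [Function.comp_def] using h3
        simp only [hadj1]
        rwa [inner_neg_left, hA.inner_eq (hvm (-s) m) h, neg_neg] at h2
      have hc : Continuous fun s => inner ℝ (e m) (L s y) := by
        have := hLcont y
        fun_prop
      have h2 := intervalIntegral.integral_eq_sub_of_hasDerivAt (a := 0) (b := t)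
        (fun s _ => h1 s) (hc.intervalIntegrable _ _)
      have h3 := (innerSL ℝ (e m)).intervalIntegral_comp_comm
        ((hLcont y).intervalIntegrable (μ := volume) 0 t)
      rw [hL0] at h2
      rw [inner_add_right, ← sub_eq_iff_eq_add', ← h2]
      exact h3
    have h1 := ((hLcont y).integral_hasStrictDerivAt 0 0).hasDerivAt.const_add x
    rw [hL0] at h1
    simpa only [← hint] using h1
  refine ⟨fun t => (L t).toContinuousLinearMap, ?_, hLadd, hLcont, fun x y => ⟨fun h => ?_, hgen⟩⟩
  · ext x
    exact hL0 x
  -- the generator is skew-symmetric, and the skew-adjoint `A` has no proper skew-symmetric extension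
  · refine hA.mapsAt_of_forall_inner fun z z' hz => ?_
    have h1 := HasDerivAt.inner ℝ h (hasDerivAt_const (0 : ℝ) z)
    have h2 : HasDerivAt (fun t => L (-t) z) (-z') 0 := by
      have h3 : HasDerivAt (fun t => L t z) z' (-(0 : ℝ)) := by
        rw [neg_zero]
        exact hgen hz
      simpa [Function.comp_def] using h3.scomp (0 : ℝ) (hasDerivAt_neg (0 : ℝ))
    have h4 := HasDerivAt.inner ℝ (hasDerivAt_const (0 : ℝ) x) h2
    have h5 := h1.unique (h4.congr_of_eventuallyEq (Eventually.of_forall fun t => hadj t x z))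
    simpa using h5

theorem isGroupGeneratedBy_expGroup (hA : IsSkewAdjointOp A) {e : HilbertBasis ℕ ℝ X}
    {lam : ℕ → ℝ} (he : IsEigenbasis (adjointMulSelf A) e lam) :
    IsGroupGeneratedBy A (expGroup A) := by
  obtain ⟨a, ha⟩ := he.exists_mapsAt hA
  have h := exists_isGroupGeneratedBy hA ha
  rw [expGroup, dif_pos h]
  exact h.choose_spec

end GroupExistence

/-! ### Spectral gaps and the group on `X^σ` -/

section ScaleGroup

open Filter Topology MeasureTheory

variable {X : Type*} [NormedAddCommGroup X] [InnerProductSpace ℝ X]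

/-- An operator with compact resolvent has no eigenvalue of infinite multiplicity, so the
nondecreasing sequence of eigenvalues has arbitrarily late jumps. -/
theorem IsEigenbasis.exists_gap {B : X →ₗ.[ℝ] X} (hB : HasCompactResolvent B)
    {e : HilbertBasis ℕ ℝ X} {lam : ℕ → ℝ} (he : IsEigenbasis B e lam) (n₀ : ℕ) :
    ∃ n ≥ n₀, ∀ j < n, ∀ k ≥ n, lam j ≠ lam k := by
  by_contra! hcon
  -- without jumps after `n₀` the eigenvalue is constant from there on, and the compact resolvent
  -- would act as a scalar on infinitely many orthonormal vectors
  have hconst : ∀ n ≥ n₀, lam n = lam n₀ := by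
    intro n hn
    induction n, hn using Nat.le_induction with
    | base => rfl
    | succ n hn ih =>
      obtain ⟨j, hj, k, hk, hjk⟩ := hcon (n + 1) (by omega)
      refine le_antisymm ?_ (he.mono (by omega))
      rw [← ih]
      calc lam (n + 1) ≤ lam k := he.mono hk
        _ = lam j := hjk.symm
        _ ≤ lam n := he.mono (by omega)
  obtain ⟨μ, R, hR, -, hR2⟩ := hB
  have hRe : ∀ j, (lam j - μ) • R (e j) = e j := by
    intro j
    obtain ⟨h, hj⟩ := he.eigen j
    have h1 := hR2 ⟨e j, h⟩
    rw [hj] at h1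
    simpa [sub_smul] using h1
  have hRn : ∀ i, (lam n₀ - μ) • R (e (n₀ + i)) = e (n₀ + i) := fun i => by
    rw [← hconst (n₀ + i) (by omega)]
    exact hRe _
  obtain ⟨K, hK, hRK⟩ := hR.image_closedBall_subset_compact (𝕜₁ := ℝ) (f := (R : X →ₗ[ℝ] X)) 1
  have hmem : ∀ i, R (e (n₀ + i)) ∈ K := fun i =>
    hRK ⟨e (n₀ + i), by simp [e.orthonormal.1], rfl⟩
  obtain ⟨x, -, φ, hφ, hlim⟩ := hK.tendsto_subseq hmem
  have hlim2 : Tendsto (fun i => e (n₀ + φ i)) atTop (𝓝 ((lam n₀ - μ) • x)) := by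
    have := hlim.const_smul (lam n₀ - μ)
    simpa only [Function.comp_apply, hRn] using this
  have hlim3 := (hlim2.comp (tendsto_add_atTop_nat 1)).sub hlim2
  rw [sub_self] at hlim3
  have h2 : ∀ i, ‖e (n₀ + φ (i + 1)) - e (n₀ + φ i)‖ ^ 2 = 2 := by
    intro i
    have hne : n₀ + φ (i + 1) ≠ n₀ + φ i := by
      have : φ i < φ (i + 1) := hφ (Nat.lt_succ_self i)
      omega
    rw [norm_sub_sq_real, e.orthonormal.1, e.orthonormal.1, e.orthonormal.2 hne]
    norm_num
  have h3 := (hlim3.norm.pow 2)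
  simp only [Function.comp_def, h2] at h3
  have h4 := tendsto_nhds_unique h3 tendsto_const_nhds
  norm_num at h4

variable {e : HilbertBasis ℕ ℝ X} {lam : ℕ → ℝ} {σ : ℝ}

/-- The inclusion `X^σ ↪ X` as a bounded operator. -/
def toXL (e : HilbertBasis ℕ ℝ X) (lam : ℕ → ℝ) (σ : ℝ) : Scale e lam σ →L[ℝ] X :=
  ((ContinuousLinearMap.fst ℝ X X).comp
    (WithLp.prodContinuousLinearEquiv 2 ℝ X X).toContinuousLinearMap).comp
      (scaleSubmodule e lam σ).subtypeL

@[simp] theorem toXL_apply (x : Scale e lam σ) : toXL e lam σ x = x.toX := rfl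

/-- The element of `X^σ` with the components `x` and `B^{σ/2} x = y`. -/
def scaleMk (x y : X) (h : ∀ j, inner ℝ (e j) y = lam j ^ (σ / 2) * inner ℝ (e j) x) :
    Scale e lam σ :=
  ⟨WithLp.toLp 2 (x, y), h⟩

/-- The operator induced on `X^σ` by an operator on `X` that commutes with `B^{σ/2}`. -/
def scaleLift (e : HilbertBasis ℕ ℝ X) (lam : ℕ → ℝ) (σ : ℝ) (L : X →L[ℝ] X)
    (hL : ∀ x y : X, (∀ j, inner ℝ (e j) y = lam j ^ (σ / 2) * inner ℝ (e j) x) →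
      ∀ j, inner ℝ (e j) (L y) = lam j ^ (σ / 2) * inner ℝ (e j) (L x)) :
    Scale e lam σ →L[ℝ] Scale e lam σ :=
  (((WithLp.prodContinuousLinearEquiv 2 ℝ X X).symm.toContinuousLinearMap.comp
    ((L.prodMap L).comp (WithLp.prodContinuousLinearEquiv 2 ℝ X X).toContinuousLinearMap)).comp
      (scaleSubmodule e lam σ).subtypeL).codRestrict (scaleSubmodule e lam σ)
        (fun p => hL _ _ p.2)

/-- Differentiability in the graph norm is differentiability of `x` and of `B^{σ/2} x`. -/
theorem hasDerivAt_scale {x : ℝ → Scale e lam σ} {x' : Scale e lam σ} {t : ℝ}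
    (h1 : HasDerivAt (fun t => (x t : WithLp 2 (X × X)).fst) (x' : WithLp 2 (X × X)).fst t)
    (h2 : HasDerivAt (fun t => (x t : WithLp 2 (X × X)).snd) (x' : WithLp 2 (X × X)).snd t) :
    HasDerivAt x x' t := by
  have h3 : HasDerivAt (fun t => (x t : WithLp 2 (X × X))) (x' : WithLp 2 (X × X)) t :=
    (WithLp.prodContinuousLinearEquiv 2 ℝ X X).symm.hasFDerivAt.comp_hasDerivAt t (h1.prodMk h2)
  rw [hasDerivAt_iff_tendsto_slope] at h3 ⊢
  exact tendsto_subtype_rng.2 h3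

/-- For a finite-rank operator `P`, strong differentiability of `t ↦ G t` on the range of `P` gives
differentiability of `t ↦ G t ∘ P` in operator norm. -/
theorem hasDerivAt_comp_finiteRank {E ι : Type*} [NormedAddCommGroup E] [NormedSpace ℝ E]
    {G : ℝ → E →L[ℝ] E} {P : E →L[ℝ] E} {s : Finset ι} {ℓ : ι → E →L[ℝ] ℝ} {ε α : ι → E}
    (hd : ∀ j t, HasDerivAt (fun t => G t (ε j)) (G t (α j)) t)
    (hP : ∀ x, P x = ∑ j ∈ s, ℓ j x • ε j) (t : ℝ) :
    HasDerivAt (fun t => (G t).comp P) ((G t).comp (∑ j ∈ s, (ℓ j).smulRight (α j))) t := by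
  have hdj : ∀ j, HasDerivAt (fun t => (ℓ j).smulRight (G t (ε j)))
      ((ℓ j).smulRight (G t (α j))) t := fun j =>
    (ContinuousLinearMap.smulRightL ℝ E E (ℓ j)).hasFDerivAt.comp_hasDerivAt t (hd j t)
  have hsum := HasDerivAt.fun_sum (u := s) (x := t) fun j _ => hdj j
  refine (hsum.congr_deriv ?_).congr_of_eventuallyEq (Eventually.of_forall fun r => ?_)
  · ext1 x
    simp [_root_.sum_apply]
  · ext1 x
    simp [_root_.sum_apply, hP]

/-- If `z` lies in the closed span of the basis vectors on which the diagonal operator with symbol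
`c` is multiplication by `c₀`, then testing with `z` does not distinguish that operator from `c₀`. -/
theorem inner_eq_mul_of_block {x y z : X} {c : ℕ → ℝ} {c₀ : ℝ}
    (hz : ∀ k, c k ≠ c₀ → inner ℝ z (e k) = 0)
    (hxy : ∀ k, inner ℝ (e k) y = c k * inner ℝ (e k) x) : inner ℝ z y = c₀ * inner ℝ z x := by
  rw [← e.tsum_inner_mul_inner, ← e.tsum_inner_mul_inner, ← tsum_mul_left]
  congr 1
  ext k
  rw [hxy]
  by_cases hk : c k = c₀
  · rw [hk]; ring
  · rw [hz k hk]; ring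

variable [CompleteSpace X] {A : X →ₗ.[ℝ] X}

/-- The group preserves the eigenspaces of `A* A`. -/
theorem IsGroupGeneratedBy.inner_eq_zero {U : ℝ → X →L[ℝ] X} (hU : IsGroupGeneratedBy A U)
    (hA : IsSkewAdjointOp A) {a : ℕ → X}
    (ha : ∀ j, MapsAt A (e j) (a j) ∧ MapsAt A (a j) (-lam j • e j)) (t : ℝ) {j k : ℕ}
    (hjk : lam j ≠ lam k) : inner ℝ (U t (e j)) (e k) = 0 := by
  refine hA.inner_eq_zero (hU.mapsAt_apply (ha j).1 t) ?_ (ha k).1 (ha k).2 hjk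
  have := hU.mapsAt_apply (ha j).2 t
  rwa [map_smul] at this

/-- The group of a skew-adjoint operator acts on `X^σ` by isometries, commutes there with the
projection `P_n` at a spectral gap `n`, and `A P_n` is bounded on `X^σ`. -/
theorem exists_scaleGroup {U : ℝ → X →L[ℝ] X} (hU : IsGroupGeneratedBy A U)
    (hA : IsSkewAdjointOp A) (he : IsEigenbasis (adjointMulSelf A) e lam) {n : ℕ}
    (hn : ∀ j < n, ∀ k ≥ n, lam j ≠ lam k) :
    ∃ (G : ℝ → Scale e lam σ →L[ℝ] Scale e lam σ) (B : Scale e lam σ →L[ℝ] Scale e lam σ),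
      IsIsometryGroup G ∧ (∀ t x, (G t x).toX = U t x.toX) ∧
      (∀ t x, lowProj e lam σ n (G t x) = G t (lowProj e lam σ n x)) ∧
      ∀ t, HasDerivAt (fun t => (G t).comp (lowProj e lam σ n)) ((G t).comp B) t := by
  obtain ⟨a, ha⟩ := he.exists_mapsAt hA
  have horth : ∀ i k, inner ℝ (e i) (e k) = if i = k then (1 : ℝ) else 0 :=
    orthonormal_iff_ite.mp e.orthonormal
  have hlift : ∀ t, ∀ x y : X, (∀ j, inner ℝ (e j) y = lam j ^ (σ / 2) * inner ℝ (e j) x) →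
      ∀ j, inner ℝ (e j) (U t y) = lam j ^ (σ / 2) * inner ℝ (e j) (U t x) := by
    intro t x y hxy j
    rw [hU.inner_apply hA, hU.inner_apply hA]
    refine inner_eq_mul_of_block (c := fun k => lam k ^ (σ / 2)) (fun k hk => ?_) hxy
    exact hU.inner_eq_zero hA ha _ fun h => hk (by simp only [h])
  let G : ℝ → Scale e lam σ →L[ℝ] Scale e lam σ := fun t => scaleLift e lam σ (U t) (hlift t)
  have hGX : ∀ t x, (G t x).toX = U t x.toX := fun t x => rfl
  have hGiso : IsIsometryGroup G := by
    refine ⟨?_, fun s t => ?_, fun x => ?_, fun t x => ?_⟩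
    · ext1 x
      exact Scale.toX_injective (hU.apply_zero _)
    · ext1 x
      exact Scale.toX_injective (hU.apply_add s t _)
    · refine Continuous.subtype_mk ?_ _
      exact (WithLp.prodContinuousLinearEquiv 2 ℝ X X).symm.continuous.comp
        ((hU.continuous _).prodMk (hU.continuous _))
    · have h : ∀ p : Scale e lam σ, ‖p‖ ^ 2
          = ‖(p : WithLp 2 (X × X)).fst‖ ^ 2 + ‖(p : WithLp 2 (X × X)).snd‖ ^ 2 := fun p =>
        WithLp.prod_norm_sq_eq_of_L2 (p : WithLp 2 (X × X))
      rw [← sq_eq_sq₀ (norm_nonneg _) (norm_nonneg _), h, h]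
      show ‖U t (x : WithLp 2 (X × X)).fst‖ ^ 2 + ‖U t (x : WithLp 2 (X × X)).snd‖ ^ 2 = _
      rw [hU.norm_map hA, hU.norm_map hA]
  have hcomm : ∀ t (x : X), lowProjX e n (U t x) = U t (lowProjX e n x) := by
    intro t x
    refine HilbertBasis.ext_inner (e := e) fun j => ?_
    rw [inner_lowProjX, hU.inner_apply hA, hU.inner_apply hA]
    have h := inner_eq_mul_of_block (e := e) (x := x) (y := lowProjX e n x) (z := U (-t) (e j))
      (c := fun k => if k < n then (1 : ℝ) else 0) (c₀ := if j < n then 1 else 0) ?_ ?_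
    · rw [h]; split_ifs <;> simp
    · intro k hk
      refine hU.inner_eq_zero hA ha _ fun h => hk ?_
      by_cases hj : j < n <;> by_cases hkn : k < n
      · simp [hj, hkn]
      · exact absurd h (hn j hj k (not_lt.1 hkn))
      · exact absurd h.symm (hn k hkn j (not_lt.1 hj))
      · simp [hj, hkn]
    · intro k
      rw [inner_lowProjX]
      split_ifs <;> simp
  -- the elements `e_j` and `A e_j` of `X^σ`
  let ε : ℕ → Scale e lam σ := fun j => scaleMk (e j) (lam j ^ (σ / 2) • e j) fun k => by
    rw [real_inner_smul_right, horth]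
    split_ifs with h
    · rw [h]
    · simp
  let α : ℕ → Scale e lam σ := fun j => scaleMk (a j) (lam j ^ (σ / 2) • a j) fun k => by
    rw [real_inner_smul_right]
    by_cases h : lam k = lam j
    · rw [h]
    · rw [hA.inner_eq_zero (ha k).1 (ha k).2 (ha j).2 ((ha j).1.smul _) h]
      simp
  let ℓ : ℕ → Scale e lam σ →L[ℝ] ℝ := fun j => (innerSL ℝ (e j)).comp (toXL e lam σ)
  have hlow : ∀ x, lowProj e lam σ n x = ∑ j ∈ Finset.range n, ℓ j x • ε j := by
    intro x
    apply Scale.toX_injective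
    rw [toX_lowProj, ← toXL_apply (∑ j ∈ Finset.range n, ℓ j x • ε j), map_sum]
    simp only [lowProjX, _root_.sum_apply, map_smul]
    rfl
  refine ⟨G, ∑ j ∈ Finset.range n, (ℓ j).smulRight (α j), hGiso, hGX, fun t x => ?_, fun t => ?_⟩
  · apply Scale.toX_injective
    rw [toX_lowProj, hGX, hGX, toX_lowProj, hcomm]
  · have hd : ∀ j t, HasDerivAt (fun t => G t (ε j)) (G t (α j)) t := fun j t =>
      hasDerivAt_scale (hU.hasDerivAt (ha j).1 t) (hU.hasDerivAt ((ha j).1.smul _) t)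
    exact hasDerivAt_comp_finiteRank hd hlow t

end ScaleGroup

/-! ### Analyticity of the observed solution -/

theorem mainTheorem1
    {X : Type*} [NormedAddCommGroup X] [InnerProductSpace ℝ X] [CompleteSpace X]
    [TopologicalSpace.SeparableSpace X]
    -- `A` is skew-adjoint and `A* A` has compact resolvent; `e` is an orthonormal eigenbasis
    (A : X →ₗ.[ℝ] X) (hA : IsSkewAdjointOp A) (hAc : HasCompactResolvent (adjointMulSelf A))
    (e : HilbertBasis ℕ ℝ X) (lam : ℕ → ℝ) (he : IsEigenbasis (adjointMulSelf A) e lam)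
    (σ : ℝ) (hσ : 0 ≤ σ)
    (T Tstar R₀ R₁ : ℝ) (n₀ : ℕ) (hT : 0 < T) (hTstar : T < Tstar) (hR₀ : 0 < R₀) (hR₁ : 0 < R₁)
    -- the compact sets `𝒜 ⊆ X^σ` and `𝒦 ⊆ C⁰([0,T*], X^σ)`, stable under all `P_n`
    (𝒜 : Set (Scale e lam σ)) (h𝒜 : IsCompact 𝒜)
    (h𝒜P : ∀ n, ∀ a ∈ 𝒜, lowProj e lam σ n a ∈ 𝒜)
    (𝒦 : Set C(Icc 0 Tstar, Scale e lam σ)) (h𝒦 : IsCompact 𝒦) (h𝒦R : ∀ φ ∈ 𝒦, ‖φ‖ ≤ R₀)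
    (h𝒦P : ∀ n, ∀ φ ∈ 𝒦,
      (lowProj e lam σ n : C(Scale e lam σ, Scale e lam σ)).comp φ ∈ 𝒦)
    -- the sources
    (h₁ h₂ : C(Icc 0 Tstar, Scale e lam σ))
    (hh₁ : h₁ ∈ pathBall Tstar R₀ 𝒜 ∩ 𝒦) (hh₂ : h₂ ∈ pathBall Tstar R₁ 𝒜)
    (μ : ℝ) (hμ : 0 < μ) (H₁ H₂ : ℂ → Complexified (Scale e lam σ))
    (hH₁ : IsHolomorphicExtension h₁ μ H₁) (hH₂ : IsHolomorphicExtension h₂ μ H₂)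
    (hH₁R : ∀ z ∈ Icc 0 Tstar ×ℂ Icc (-μ) μ, ‖(H₁ z).re‖ ≤ R₀)
    -- the nonlinearity and the observation operator
    (f : Scale e lam σ → Scale e lam σ) (hf : NonlinearityAssumption f R₀)
    (C : Scale e lam σ →L[ℝ] Scale e lam σ)
    (hobs : UniformObservability A f C hT.le n₀ (pathBall T (3 * R₀) (𝒜 + 𝒜)))
    -- the observed solution
    (u : C(Icc 0 Tstar, Scale e lam σ)) (hu𝒦 : u ∈ 𝒦) (hu𝒜 : ∀ t, u t ∈ 𝒜)
    (hu : IsMildSolution A (hT.trans hTstar).le u (fun s => f (u s + h₁ s) + h₂ s))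
    (hCu : ∀ t, C (u t) = 0) :
    AnalyticOnNhd ℝ (IccExtend (hT.trans hTstar).le u) (Ioo 0 Tstar) := by
  have hS : 0 ≤ Tstar := (hT.trans hTstar).le
  have hU := isGroupGeneratedBy_expGroup hA he
  obtain ⟨n, hn, hgap⟩ := he.exists_gap hAc n₀
  obtain ⟨G, B, hG, hGX, hPG, hB⟩ := exists_scaleGroup (σ := σ) hU hA he hgap
  have hPP : ∀ x, lowProj e lam σ n (lowProj e lam σ n x) = lowProj e lam σ n x := fun x => by
    apply Scale.toX_injective
    refine HilbertBasis.ext_inner (e := e) fun j => ?_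
    simp only [toX_lowProj, inner_lowProjX]
    split_ifs <;> rfl
  have huc : Continuous (IccExtend hS u) := u.continuous.Icc_extend'
  have hh₁c : Continuous (IccExtend hS h₁) := h₁.continuous.Icc_extend'
  have hh₂c : Continuous (IccExtend hS h₂) := h₂.continuous.Icc_extend'
  have hnorm : ∀ t, ‖IccExtend hS u t + IccExtend hS h₁ t‖ ≤ 2 * R₀ := fun t => by
    have h1 := ((u.norm_coe_le_norm (projIcc 0 Tstar hS t)).trans (h𝒦R u hu𝒦))
    have h2 := ((h₁.norm_coe_le_norm (projIcc 0 Tstar hS t)).trans hh₁.1.1)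
    refine (norm_add_le _ _).trans ?_
    change ‖u (projIcc 0 Tstar hS t)‖ + ‖h₁ (projIcc 0 Tstar hS t)‖ ≤ _
    linarith
  -- identities in `X^σ` are checked in `X`
  have hint : ∀ {g : ℝ → Scale e lam σ}, Continuous g → ∀ t : ℝ,
      (∫ s in (0 : ℝ)..t, G (t - s) (g s)).toX = ∫ s in (0 : ℝ)..t, expGroup A (t - s) (g s).toX := by
    intro g hg t
    have h := (toXL e lam σ).intervalIntegral_comp_comm (hG.intervalIntegrable hg t 0 t)
    simp only [toXL_apply, hGX] at h
    exact h.symm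
  have hfdiff : Continuous f := hf.contDiff.continuous
  have hg : Continuous fun s => f (IccExtend hS u s + IccExtend hS h₁ s) + IccExtend hS h₂ s :=
    (hfdiff.comp (huc.add hh₁c)).add hh₂c
  have hu' : ∀ t ∈ Icc 0 Tstar, IccExtend hS u t = G t (IccExtend hS u 0)
      + ∫ s in (0 : ℝ)..t, G (t - s) (f (IccExtend hS u s + IccExtend hS h₁ s)
        + IccExtend hS h₂ s) := by
    intro t ht
    apply Scale.toX_injective
    rw [← toXL_apply (_ + _), map_add, toXL_apply, toXL_apply, hGX,
      hint hg, IccExtend_of_mem hS u ht,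
      IccExtend_left]
    exact hu ⟨t, ht⟩
  have hCu' : ∀ t ∈ Icc 0 Tstar, C (IccExtend hS u t) = 0 := fun t _ => hCu _
  obtain ⟨c, hc, hobs⟩ := hobs
  intro t ht
  -- a window `[t₀, t₀ + T]` inside `(0, T*)` with `t = t₀ + s₀`
  have hpos : 0 < Tstar := hT.trans hTstar
  obtain ⟨t₀, s₀, ht₀, ht₀S, hs₀, rfl⟩ :
      ∃ t₀ s₀, 0 < t₀ ∧ t₀ + T < Tstar ∧ s₀ ∈ Icc 0 T ∧ t = t₀ + s₀ := by
    refine ⟨t * (Tstar - T) / Tstar, t * T / Tstar, ?_, ?_, ⟨?_, ?_⟩, ?_⟩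
    · exact div_pos (mul_pos ht.1 (sub_pos.2 hTstar)) hpos
    · have : t * (Tstar - T) / Tstar < Tstar - T := by
        rw [div_lt_iff₀ hpos, mul_comm]
        exact mul_lt_mul_of_pos_left ht.2 (sub_pos.2 hTstar)
      linarith
    · exact div_nonneg (mul_nonneg ht.1.le hT.le) hpos.le
    · rw [div_le_iff₀ hpos, mul_comm]
      exact mul_le_mul_of_nonneg_left ht.2.le hT.le
    · field_simp
      ring
  refine analyticAt_of_observable_window hG hT.le hPP hPG hB hf hh₁c hh₂c huc
    (fun t => (hnorm t).trans_lt (by linarith)) hμ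
    (fun t ht => ?_) (fun t ht => ?_) hH₁.differentiableOn hH₂.differentiableOn hu' hCu'
    ht₀ ht₀S hc ?_ hs₀
  · rw [IccExtend_of_mem hS h₁ ht]
    exact hH₁.extends_real ⟨t, ht⟩
  · rw [IccExtend_of_mem hS h₂ ht]
    exact hH₂.extends_real ⟨t, ht⟩
  intro w hw hweq
  refine hobs n hn (window (huc.add hh₁c) T t₀) ⟨?_, fun s => ?_⟩ w ⟨fun s => ⟨w s, hw s⟩, fun s => ?_⟩
  · refine (ContinuousMap.norm_le _ (by positivity)).2 fun s => ?_
    exact (hnorm _).trans (by linarith)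
  · exact add_mem_add (hu𝒜 _) (hh₁.1.2 _)
  · rw [hweq s, ← toXL_apply (_ + _), map_add, toXL_apply, toXL_apply, hGX, hint ?_]
    · rfl
    · have h1 : Continuous fun s => w (projIcc 0 T hT.le s) :=
        w.continuous.comp continuous_projIcc
      have h2 : Continuous fun s => fderiv ℝ f (window (huc.add hh₁c) T t₀ (projIcc 0 T hT.le s)) :=
        (hf.contDiff.continuous_fderiv (by norm_num)).comp
          ((window (huc.add hh₁c) T t₀).continuous.comp continuous_projIcc)
      exact (1 - lowProj e lam σ n).continuous.comp (h2.clm_apply h1)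

end
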